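/- \textbf{Setting.} For a real order-$d$ tensor $\mathcal A\in\mathbb R^{n\times\cdots\times n}$ with entries $\mathcal A_i$, $i\in[n]^d$, let $\|\mathcal A\|_F=\big(\sum_i \mathcal A_i^2\big)^{1/2}$ and let $\|\mathcal A\|_2=\sup\big|\sum_{i\in[n]^d}\mathcal A_i\,(x_1)_{i_1}\cdots(x_d)_{i_d}\big|$, the supremum being over all Euclidean unit vectors $x_1,\dots,x_d\in\mathbb R^n$. For a real parameter $s>0$ the sparsification algorithm returns a random tensor $\widetilde{\mathcal A}$ of the same size whose entries are chosen independently of each other as follows. \begin{itemize} \item If $\mathcal A_i^2\ge \|\mathcal A\|_F^2/s$, then $\widetilde{\mathcal A}_i=\mathcal A_i$. \item Else, if $\mathcal A_i^2\le \frac{\ln^2 n}{n^{d/2}}\cdot\frac{\|\mathcal A\|_F^2}{s}$, then $\widetilde{\mathcal A}_i=0$. \item Else, with $p_i=s\mathcal A_i^2/\|\mathcal A\|_F^2$, $\widetilde{\mathcal A}_i=\mathcal A_i/p_i$ with probability $p_i$ and $\widetilde{\mathcal A}_i=0$ with probability $1-p_i$. \end{itemize} \textbf{Theorem.} There are absolute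 constants $c,C,c',C'>0$ such that the following hold. \begin{enumerate} \item For all integers $n\ge 300$ and $2\le d\le 0.5\ln n$, every order-$d$ tensor $\mathcal A\in\mathbb R^{n\times\cdots\times n}$ and every $s>0$, with probability at least $1-1/n$, $$\|\mathcal A-\widetilde{\mathcal A}\|_2\le c\,d^{3/2}\,8^d\sqrt{\frac{n^{d/2}\ln^3 n}{s}}\;\|\mathcal A\|_F .$$ \item For all such $n,d,\mathcal A$, every $\epsilon>0$ and every $s\ge C\,\dfrac{d^3\,64^d\,n^{d/2}\ln^3 n}{\epsilon^2}$, with probability at least $1-1/n$, $\|\mathcal A-\widetilde{\mathcal A}\|_2\le\epsilon\|\mathcal A\|_F$. \item (Matrices, $d=2$.) For all $n\ge 300$, every matrix $M\in\mathbb R^{n\times n}$ and every $s>0$, the output $\widetilde M$ of the algorithm on $M$ (as an order-2 tensor) satisfies, with probability at least $1-1/n$, $$\|M-\widetilde M\|_2\le c'\sqrt{\frac{n\ln^3 n}{s}}\;\|M\|_F ,$$ where $\|\cdot\|_2$ is the usual spectral (operator) norm of a matrix. \item For all such $n,M$, every $\epsilon>0$ and every $s\ge C'\,n\ln^3 n/\epsilon^2$,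 with probability at least $1-1/n$, $\|M-\widetilde M\|_2\le\epsilon\|M\|_F$. \end{enumerate} -/

import Mathlib

open MeasureTheory

/-- Real tensors of order `d` with all `d` modes of dimension `n`. -/
abbrev Tensor (d n : ℕ) : Type := (Fin d → Fin n) → ℝ

namespace Tensor

variable {d n : ℕ}

/-- The Frobenius norm: the square root of the sum of the squares of the entries. -/
noncomputable def frobNorm (A : Tensor d n) : ℝ := Real.sqrt (∑ i, A i ^ 2)

/-- The full contraction of `A` with `x 0` in the first mode, `x 1` in the second mode, and so
on. -/
noncomputable def contract (A : Tensor d n) (x : Fin d → EuclideanSpace ℝ (Fin n)) : ℝ :=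
  ∑ i, A i * ∏ j, x j (i j)

/-- The spectral norm: the supremum of the absolute values of the full contractions with
Euclidean unit vectors. -/
noncomputable def spectralNorm (A : Tensor d n) : ℝ :=
  sSup {r | ∃ x : Fin d → EuclideanSpace ℝ (Fin n), (∀ j, ‖x j‖ = 1) ∧ r = |A.contract x|}

/-- The set in the definition of the spectral norm is bounded, so that its `sSup` is a genuine
supremum as soon as `0 < n`. -/
theorem bddAbove_contract (A : Tensor d n) :
    BddAbove {r | ∃ x : Fin d → EuclideanSpace ℝ (Fin n),
      (∀ j, ‖x j‖ = 1) ∧ r = |A.contract x|} := by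
  refine ⟨∑ i, |A i|, ?_⟩
  rintro r ⟨x, hx, rfl⟩
  refine (Finset.abs_sum_le_sum_abs _ _).trans (Finset.sum_le_sum fun i _ => ?_)
  rw [abs_mul, Finset.abs_prod]
  refine mul_le_of_le_one_right (abs_nonneg _)
    (Finset.prod_le_one (fun _ _ => abs_nonneg _) fun j _ => ?_)
  have h := EuclideanSpace.norm_eq (x j)
  have h2 := PiLp.norm_apply_le (x j) (i j)
  rw [hx j] at h2
  simpa using h2

/-- The law of the output of the sparsification step on a single entry `a`. Here `F` is the
squared Frobenius norm of the whole tensor, `s` is the sampling parameter and `τ` is the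
(relative) threshold below which entries are dropped. -/
noncomputable def entryLaw (F s τ a : ℝ) : Measure ℝ :=
  if F / s ≤ a ^ 2 then Measure.dirac a
  else if a ^ 2 ≤ τ * (F / s) then Measure.dirac 0
  else ENNReal.ofReal (s * a ^ 2 / F) • Measure.dirac (a / (s * a ^ 2 / F)) +
    ENNReal.ofReal (1 - s * a ^ 2 / F) • Measure.dirac 0

/-- The law of the random tensor returned by the sparsification algorithm on input `A` with
sampling parameter `s`: the entries are treated independently of each other. -/
noncomputable def sparsifyLaw (A : Tensor d n) (s : ℝ) : Measure (Tensor d n) :=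
  Measure.pi fun i =>
    entryLaw (A.frobNorm ^ 2) s (Real.log n ^ 2 / (n : ℝ) ^ ((d : ℝ) / 2)) (A i)

theorem isProbabilityMeasure_entryLaw {F : ℝ} (hF : 0 ≤ F) (s τ a : ℝ) :
    IsProbabilityMeasure (entryLaw F s τ a) := by
  unfold entryLaw
  split_ifs with h₁ h₂
  · infer_instance
  · infer_instance
  · have hs : 0 < s := by
      by_contra hs
      exact h₁ ((div_nonpos_of_nonneg_of_nonpos hF (not_lt.mp hs)).trans (sq_nonneg a))
    have hp₀ : 0 ≤ s * a ^ 2 / F := by positivity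
    have hp₁ : s * a ^ 2 / F ≤ 1 := by
      refine div_le_one_of_le₀ ?_ hF
      have := (lt_div_iff₀ hs).mp (not_le.mp h₁)
      linarith
    constructor
    simp only [Measure.coe_add, Measure.coe_smul, Pi.add_apply, Pi.smul_apply,
      measure_univ, smul_eq_mul, mul_one]
    rw [← ENNReal.ofReal_add hp₀ (by linarith)]
    simp

instance (A : Tensor d n) (s : ℝ) : IsProbabilityMeasure (A.sparsifyLaw s) := by
  have := fun i => isProbabilityMeasure_entryLaw (sq_nonneg A.frobNorm) s
    (Real.log n ^ 2 / (n : ℝ) ^ ((d : ℝ) / 2)) (A i)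
  unfold sparsifyLaw
  infer_instance

/-- A square matrix as a tensor of order two. -/
def ofMatrix (M : Matrix (Fin n) (Fin n) ℝ) : Tensor 2 n := fun i => M (i 0) (i 1)

/-- A tensor of order two as a square matrix. -/
def toMatrix (T : Tensor 2 n) : Matrix (Fin n) (Fin n) ℝ := Matrix.of fun i j => T ![i, j]

end Tensor

/-- The Frobenius norm of a square matrix. -/
noncomputable def matrixFrobNorm {n : ℕ} (M : Matrix (Fin n) (Fin n) ℝ) : ℝ :=
  Real.sqrt (∑ i, ∑ j, M i j ^ 2)

/-- The spectral norm of a square matrix: its operator norm on Euclidean space. -/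
noncomputable def matrixSpectralNorm {n : ℕ} (M : Matrix (Fin n) (Fin n) ℝ) : ℝ :=
  ‖Matrix.toEuclideanCLM (n := Fin n) (𝕜 := ℝ) M‖

/-!
The error `A - T` splits into the bias `A - A.mean s`, whose Frobenius norm is small because only
entries below the threshold contribute, and the noise `T - A.mean s`, whose entries are independent,
centred and bounded.

The unit ball lies in the convex hull of the vectors of norm at most `√5` with entries `0` and
`± 2 ^ (-k)`, and the absolute value of a multilinear form is convex in each argument, so it is
enough to bound the form of the noise at tuples of such vectors. A single union bound over them is
too lossy. Instead, the sum defining the form is split into `O(log n)` levels by the size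
`2 ^ (-m)` of the smallest factor of a term. On level `m` the squared coefficients carry a factor
`4 ^ (-m)`, and summing the other factors bounds the weighted sum of squares of the noise by its
largest sum of squares along a fibre of the tensor. The tail exponent thus gains a factor `4 ^ m`,
which matches the logarithm `O(4 ^ m * log n)` of the number of net vectors with nonzero entries at
least `2 ^ (-m)`. The tail bound is self-normalised, involving the random sum of squares, so that it
is subgaussian although single entries of the noise can be large; one union bound over the fibres
controls that sum.
-/

section ExponentialMoments

theorem exp_sub_sq_le (x : ℝ) : Real.exp (x - x ^ 2) ≤ 1 + x + x ^ 2 := by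
  have hpos : 0 < x ^ 2 - x + 1 := by nlinarith [sq_nonneg (x - 1 / 2)]
  have hprod : 1 ≤ (1 + x + x ^ 2) * (x ^ 2 - x + 1) := by
    nlinarith [sq_nonneg x, sq_nonneg (x ^ 2)]
  rw [← neg_sub, Real.exp_neg, inv_le_comm₀ (Real.exp_pos _) (by nlinarith)]
  calc (1 + x + x ^ 2)⁻¹ ≤ x ^ 2 - x + 1 := (inv_le_iff_one_le_mul₀' (by nlinarith)).2 hprod
    _ ≤ Real.exp (x ^ 2 - x) := Real.add_one_le_exp _

theorem exp_le_one_add_two_mul {x : ℝ} (h0 : 0 ≤ x) (h1 : x ≤ 1) : Real.exp x ≤ 1 + 2 * x := by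
  have h := Real.abs_exp_sub_one_le (x := x) (by rwa [abs_of_nonneg h0])
  rw [abs_of_nonneg h0] at h
  linarith [le_abs_self (Real.exp x - 1)]

variable {Ω : Type*} [MeasurableSpace Ω] {P : Measure Ω} {X : Ω → ℝ}

theorem integrable_exp_of_ae_le [IsFiniteMeasure P] (hX : AEStronglyMeasurable X P) {C : ℝ}
    (hC : ∀ᵐ ω ∂P, X ω ≤ C) : Integrable (fun ω => Real.exp (X ω)) P := by
  refine .of_bound (Real.continuous_exp.comp_aestronglyMeasurable hX) (Real.exp C) ?_
  filter_upwards [hC] with ω hω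
  rwa [Real.norm_of_nonneg (Real.exp_nonneg _), Real.exp_le_exp]

theorem integrable_exp_sub_sq [IsFiniteMeasure P] (hX : AEStronglyMeasurable X P) :
    Integrable (fun ω => Real.exp (X ω - X ω ^ 2)) P :=
  integrable_exp_of_ae_le (hX.sub (hX.pow 2)) (C := 1) <| .of_forall fun ω => by
    nlinarith [sq_nonneg (X ω - 1 / 2)]

theorem integral_exp_sub_sq_le [IsProbabilityMeasure P] (hX : MemLp X 2 P)
    (hmean : ∫ ω, X ω ∂P = 0) :
    ∫ ω, Real.exp (X ω - X ω ^ 2) ∂P ≤ Real.exp (∫ ω, X ω ^ 2 ∂P) := by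
  have hint : Integrable X P := hX.integrable (by norm_num)
  have hint_one : Integrable (fun ω => 1 + X ω) P := (integrable_const 1).add hint
  calc ∫ ω, Real.exp (X ω - X ω ^ 2) ∂P
      ≤ ∫ ω, (1 + X ω + X ω ^ 2) ∂P :=
        integral_mono (integrable_exp_sub_sq hX.1) (hint_one.add hX.integrable_sq)
          fun ω => exp_sub_sq_le (X ω)
    _ = ∫ ω, X ω ^ 2 ∂P + 1 := by
        rw [integral_add hint_one hX.integrable_sq, integral_add (integrable_const 1) hint, hmean]
        simp [add_comm]
    _ ≤ Real.exp (∫ ω, X ω ^ 2 ∂P) := Real.add_one_le_exp _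

theorem integral_exp_le_exp_two_mul_integral [IsProbabilityMeasure P]
    (hX : AEStronglyMeasurable X P) (h0 : ∀ᵐ ω ∂P, 0 ≤ X ω) (h1 : ∀ᵐ ω ∂P, X ω ≤ 1) :
    ∫ ω, Real.exp (X ω) ∂P ≤ Real.exp (2 * ∫ ω, X ω ∂P) := by
  have hint : Integrable X P := .of_bound hX 1 <| by
    filter_upwards [h0, h1] with ω hω0 hω1
    rwa [Real.norm_of_nonneg hω0]
  calc ∫ ω, Real.exp (X ω) ∂P ≤ ∫ ω, (1 + 2 * X ω) ∂P :=
        integral_mono_ae (integrable_exp_of_ae_le hX h1)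
          ((integrable_const 1).add (hint.const_mul 2)) <| by
          filter_upwards [h0, h1] with ω using exp_le_one_add_two_mul
    _ = 2 * ∫ ω, X ω ∂P + 1 := by
        rw [integral_add (integrable_const 1) (hint.const_mul 2), integral_const_mul]
        simp [add_comm]
    _ ≤ Real.exp (2 * ∫ ω, X ω ∂P) := Real.add_one_le_exp _

end ExponentialMoments

section IndependentSums

open ProbabilityTheory

variable {Ω ι : Type*} [MeasurableSpace Ω] {P : Measure Ω} [Fintype ι] {X : ι → Ω → ℝ}

theorem measureReal_sum_ge_le_exp (hX : iIndepFun X P) (hm : ∀ i, Measurable (X i))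
    (hint : ∀ i, Integrable (fun ω => Real.exp (X i ω)) P) {c : ι → ℝ}
    (hc : ∀ i, ∫ ω, Real.exp (X i ω) ∂P ≤ Real.exp (c i)) (t : ℝ) :
    P.real {ω | t ≤ ∑ i, X i ω} ≤ Real.exp (∑ i, c i - t) := by
  have := hX.isProbabilityMeasure
  have hsum : Integrable (fun ω => Real.exp (1 * (∑ i, X i) ω)) P :=
    hX.integrable_exp_mul_sum hm fun i _ => by simpa using hint i
  have hmgf : mgf (∑ i, X i) P 1 ≤ Real.exp (∑ i, c i) := by
    rw [hX.mgf_sum hm, Real.exp_sum]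
    exact Finset.prod_le_prod (fun i _ => mgf_nonneg) fun i _ => by simpa [mgf] using hc i
  calc P.real {ω | t ≤ ∑ i, X i ω}
      ≤ Real.exp (-1 * t) * mgf (∑ i, X i) P 1 := by
        simpa using measure_ge_le_exp_mul_mgf t zero_le_one hsum
    _ ≤ Real.exp (-1 * t) * Real.exp (∑ i, c i) := by gcongr
    _ = Real.exp (∑ i, c i - t) := by rw [← Real.exp_add]; ring_nf

theorem measureReal_sum_gt_le_exp_neg (hX : iIndepFun X P) (hm : ∀ i, Measurable (X i)) {b : ℝ}
    (hb : 0 ≤ b) (h0 : ∀ i, ∀ᵐ ω ∂P, 0 ≤ X i ω) (hle : ∀ i, ∀ᵐ ω ∂P, X i ω ≤ b) (u : ℝ) :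
    P.real {ω | 2 * ∑ i, ∫ ω, X i ω ∂P + b * u < ∑ i, X i ω} ≤ Real.exp (-u) := by
  have := hX.isProbabilityMeasure
  rcases hb.eq_or_lt with rfl | hb
  · have hzero (i) : X i =ᵐ[P] 0 := by
      filter_upwards [h0 i, hle i] with ω hω0 hωle using le_antisymm hωle hω0
    have hnull : P {ω | 2 * ∑ i, ∫ ω, X i ω ∂P + 0 * u < ∑ i, X i ω} = 0 := by
      refine measure_eq_zero_iff_ae_notMem.2 ?_
      filter_upwards [ae_all_iff.2 hzero] with ω hω
      simp [hω, integral_congr_ae (hzero _)]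
    rw [measureReal_def, hnull, ENNReal.toReal_zero]
    exact Real.exp_nonneg _
  have hm' (i) : Measurable fun ω => X i ω / b := (hm i).div_const b
  have h0' (i) : ∀ᵐ ω ∂P, 0 ≤ X i ω / b := (h0 i).mono fun ω hω => by positivity
  have hle' (i) : ∀ᵐ ω ∂P, X i ω / b ≤ 1 := (hle i).mono fun ω hω => (div_le_one hb).2 hω
  have hindep : iIndepFun (fun i ω => X i ω / b) P :=
    hX.comp (fun _ x => x / b) fun _ => by fun_prop
  have hchernoff := measureReal_sum_ge_le_exp hindep hm'
    (fun i => integrable_exp_of_ae_le (hm' i).aestronglyMeasurable (hle' i))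
    (fun i => integral_exp_le_exp_two_mul_integral (hm' i).aestronglyMeasurable (h0' i) (hle' i))
    (2 * ∑ i, ∫ ω, X i ω / b ∂P + u)
  rw [← Finset.mul_sum, sub_add_cancel_left] at hchernoff
  refine (measureReal_mono fun ω hω => ?_).trans hchernoff
  simp only [integral_div, ← Finset.sum_div]
  refine le_of_lt ((lt_div_iff₀ hb).2 (lt_of_eq_of_lt ?_ hω))
  field_simp

/-- The event also controls the random sum of squares, so no exponential moment of the `X i`
themselves is needed: the Chernoff method is applied to `l X i - (l X i) ^ 2`. -/
theorem measureReal_sum_ge_and_sum_sq_le_le_exp (hX : iIndepFun X P) (hm : ∀ i, Measurable (X i))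
    (hL2 : ∀ i, MemLp (X i) 2 P) (hmean : ∀ i, ∫ ω, X i ω ∂P = 0) {v t : ℝ} (hv : 0 < v)
    (hvar : ∑ i, ∫ ω, X i ω ^ 2 ∂P ≤ v) (ht : 0 ≤ t) :
    P.real {ω | t ≤ ∑ i, X i ω ∧ ∑ i, X i ω ^ 2 ≤ v} ≤ Real.exp (-(t ^ 2 / (8 * v))) := by
  have := hX.isProbabilityMeasure
  set l := t / (4 * v) with hl
  have hl0 : 0 ≤ l := by positivity
  have hindep : iIndepFun (fun i ω => l * X i ω - (l * X i ω) ^ 2) P :=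
    hX.comp (fun _ x => l * x - (l * x) ^ 2) fun _ => by fun_prop
  have hchernoff := measureReal_sum_ge_le_exp hindep
    (fun i => by have := hm i; fun_prop)
    (fun i => integrable_exp_sub_sq ((hL2 i).const_mul l).1)
    (fun i => integral_exp_sub_sq_le ((hL2 i).const_mul l) (by
      rw [integral_const_mul, hmean, mul_zero]))
    (l * t - l ^ 2 * v)
  simp only [mul_pow, integral_const_mul, Finset.sum_sub_distrib, ← Finset.mul_sum] at hchernoff
  refine (measureReal_mono ?_).trans (hchernoff.trans (Real.exp_le_exp.2 ?_))
  · rintro ω ⟨hsum, hsq⟩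
    exact sub_le_sub (mul_le_mul_of_nonneg_left hsum hl0)
      (mul_le_mul_of_nonneg_left hsq (sq_nonneg l))
  · calc l ^ 2 * ∑ i, ∫ ω, X i ω ^ 2 ∂P - (l * t - l ^ 2 * v)
        ≤ l ^ 2 * v - (l * t - l ^ 2 * v) := by gcongr
      _ = -(t ^ 2 / (8 * v)) := by rw [hl]; field_simp; ring

theorem measureReal_abs_sum_gt_and_sum_sq_le_le_exp_neg (hX : iIndepFun X P)
    (hm : ∀ i, Measurable (X i)) (hL2 : ∀ i, MemLp (X i) 2 P) (hmean : ∀ i, ∫ ω, X i ω ∂P = 0)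
    {v u : ℝ} (hv : 0 ≤ v) (hvar : ∑ i, ∫ ω, X i ω ^ 2 ∂P ≤ v) (hu : 0 ≤ u) :
    P.real {ω | √(8 * v * u) < |∑ i, X i ω| ∧ ∑ i, X i ω ^ 2 ≤ v} ≤ 2 * Real.exp (-u) := by
  have := hX.isProbabilityMeasure
  rcases hv.eq_or_lt with rfl | hv
  · have hempty : {ω | √(8 * 0 * u) < |∑ i, X i ω| ∧ ∑ i, X i ω ^ 2 ≤ 0} = ∅ := by
      refine Set.eq_empty_of_forall_notMem fun ω ⟨hlt, hsq⟩ => ?_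
      have hzero (i) : X i ω = 0 := pow_eq_zero_iff two_ne_zero |>.1 <|
        (Finset.sum_eq_zero_iff_of_nonneg fun i _ => sq_nonneg (X i ω)).1
          (hsq.antisymm (Finset.sum_nonneg fun i _ => sq_nonneg _)) i (Finset.mem_univ i)
      simp [hzero] at hlt
    rw [hempty, measureReal_empty]
    positivity
  have hexponent : √(8 * v * u) ^ 2 / (8 * v) = u := by
    rw [Real.sq_sqrt (by positivity)]
    field_simp
  have hupper := measureReal_sum_ge_and_sum_sq_le_le_exp hX hm hL2 hmean hv hvar
    (Real.sqrt_nonneg (8 * v * u))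
  have hlower := measureReal_sum_ge_and_sum_sq_le_le_exp (X := fun i ω => -X i ω)
    (hX.comp (fun _ x => -x) fun _ => measurable_neg) (fun i => (hm i).neg) (fun i => (hL2 i).neg)
    (fun i => by rw [integral_neg, hmean, neg_zero]) hv (by simpa only [neg_sq] using hvar)
    (Real.sqrt_nonneg (8 * v * u))
  rw [hexponent] at hupper hlower
  rw [two_mul]
  refine (measureReal_mono ?_).trans ((measureReal_union_le _ _).trans (add_le_add hupper hlower))
  rintro ω ⟨habs, hsq⟩
  rcases lt_abs.1 habs with hpos | hneg
  · exact Or.inl ⟨hpos.le, hsq⟩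
  · refine Or.inr ⟨?_, by simpa only [neg_sq] using hsq⟩
    rw [Finset.sum_neg_distrib]
    exact hneg.le

end IndependentSums

namespace Tensor

section SpectralNorm

variable {d n : ℕ}

theorem frobNorm_nonneg (A : Tensor d n) : 0 ≤ A.frobNorm := Real.sqrt_nonneg _

theorem spectralNorm_nonneg (A : Tensor d n) : 0 ≤ A.spectralNorm :=
  Real.sSup_nonneg <| by rintro _ ⟨x, -, rfl⟩; exact abs_nonneg _

theorem abs_contract_le_spectralNorm (A : Tensor d n) {x : Fin d → EuclideanSpace ℝ (Fin n)}
    (hx : ∀ j, ‖x j‖ = 1) : |A.contract x| ≤ A.spectralNorm :=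
  le_csSup A.bddAbove_contract ⟨x, hx, rfl⟩

theorem contract_add (A B : Tensor d n) (x : Fin d → EuclideanSpace ℝ (Fin n)) :
    (A + B).contract x = A.contract x + B.contract x := by
  simp only [contract, Pi.add_apply, add_mul, Finset.sum_add_distrib]

theorem spectralNorm_add_le (A B : Tensor d n) :
    (A + B).spectralNorm ≤ A.spectralNorm + B.spectralNorm := by
  refine Real.sSup_le ?_ (add_nonneg A.spectralNorm_nonneg B.spectralNorm_nonneg)
  rintro _ ⟨x, hx, rfl⟩
  rw [contract_add]
  exact (abs_add_le _ _).trans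
    (add_le_add (A.abs_contract_le_spectralNorm hx) (B.abs_contract_le_spectralNorm hx))

theorem spectralNorm_neg (A : Tensor d n) : (-A).spectralNorm = A.spectralNorm := by
  simp only [spectralNorm, contract, Pi.neg_apply, neg_mul, Finset.sum_neg_distrib, abs_neg]

theorem spectralNorm_sub_le (A B : Tensor d n) :
    (A - B).spectralNorm ≤ A.spectralNorm + B.spectralNorm := by
  rw [sub_eq_add_neg, ← spectralNorm_neg B]
  exact spectralNorm_add_le A (-B)

theorem sum_sq_eq_one_of_norm_eq_one {x : EuclideanSpace ℝ (Fin n)} (hx : ‖x‖ = 1) :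
    ∑ k, x k ^ 2 = 1 := by
  rw [← EuclideanSpace.real_norm_sq_eq, hx, one_pow]

theorem spectralNorm_le_frobNorm (A : Tensor d n) : A.spectralNorm ≤ A.frobNorm := by
  refine Real.sSup_le ?_ A.frobNorm_nonneg
  rintro _ ⟨x, hx, rfl⟩
  refine Real.abs_le_sqrt ?_
  calc A.contract x ^ 2
      ≤ (∑ i, A i ^ 2) * ∑ i : Fin d → Fin n, (∏ j, x j (i j)) ^ 2 :=
        Finset.sum_mul_sq_le_sq_mul_sq _ _ _
    _ = (∑ i, A i ^ 2) * ∏ j, ∑ k, x j k ^ 2 := by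
        simp only [← Finset.prod_pow, ← Fintype.prod_sum fun (j : Fin d) k => x j k ^ 2]
    _ = ∑ i, A i ^ 2 := by simp [sum_sq_eq_one_of_norm_eq_one (hx _)]

/-- The full contraction as a multilinear map on plain coordinate vectors; unlike `contract`, it
lets one argument vary linearly, which is how the maximum principle is applied. -/
noncomputable def form (A : Tensor d n) : MultilinearMap ℝ (fun _ : Fin d => Fin n → ℝ) ℝ :=
  ∑ i, A i • (MultilinearMap.mkPiAlgebra ℝ (Fin d) ℝ).compLinearMap
    fun j => (LinearMap.proj (i j) : (Fin n → ℝ) →ₗ[ℝ] ℝ)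

theorem form_apply (A : Tensor d n) (x : Fin d → Fin n → ℝ) :
    A.form x = ∑ i, A i * ∏ j, x j (i j) := by
  simp [form]

theorem spectralNorm_le_of_abs_form_le {A : Tensor d n} {b : ℝ} (hb : 0 ≤ b)
    (h : ∀ x : Fin d → Fin n → ℝ, (∀ j, ∑ k, x j k ^ 2 ≤ 1) → |A.form x| ≤ b) :
    A.spectralNorm ≤ b := by
  refine Real.sSup_le ?_ hb
  rintro _ ⟨x, hx, rfl⟩
  have hform := h (fun j => x j) fun j => (sum_sq_eq_one_of_norm_eq_one (hx j)).le
  rwa [form_apply] at hform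

end SpectralNorm

section Matrices

variable {n : ℕ}

theorem frobNorm_ofMatrix (M : Matrix (Fin n) (Fin n) ℝ) :
    (ofMatrix M).frobNorm = matrixFrobNorm M := by
  rw [frobNorm, ← (finTwoArrowEquiv (Fin n)).symm.sum_comp, Fintype.sum_prod_type]
  simp [matrixFrobNorm, ofMatrix]

theorem ofMatrix_sub_toMatrix (M : Matrix (Fin n) (Fin n) ℝ) (T : Tensor 2 n) :
    ofMatrix (M - T.toMatrix) = ofMatrix M - T := by
  funext i
  have hi : ![i 0, i 1] = i := (finTwoArrowEquiv (Fin n)).left_inv i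
  simp [ofMatrix, toMatrix, hi]

theorem contract_ofMatrix (M : Matrix (Fin n) (Fin n) ℝ) (x y : EuclideanSpace ℝ (Fin n)) :
    (ofMatrix M).contract ![x, y] = x.ofLp ⬝ᵥ M.mulVec y.ofLp := by
  rw [contract, ← (finTwoArrowEquiv (Fin n)).symm.sum_comp, Fintype.sum_prod_type]
  simp only [dotProduct, Matrix.mulVec, Finset.mul_sum]
  refine Finset.sum_congr rfl fun i _ => Finset.sum_congr rfl fun j _ => ?_
  simp only [ofMatrix, finTwoArrowEquiv_symm_apply, Fin.prod_univ_two, Matrix.cons_val_zero,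
    Matrix.cons_val_one]
  ring

theorem matrixSpectralNorm_le_spectralNorm_ofMatrix (M : Matrix (Fin n) (Fin n) ℝ) :
    matrixSpectralNorm M ≤ (ofMatrix M).spectralNorm := by
  refine ContinuousLinearMap.opNorm_le_of_re_inner_le (spectralNorm_nonneg _) fun y x hy hx => ?_
  have hle : x.ofLp ⬝ᵥ M.mulVec y.ofLp ≤ (ofMatrix M).spectralNorm := by
    rw [← contract_ofMatrix]
    refine (le_abs_self _).trans (abs_contract_le_spectralNorm _ fun j => ?_)
    fin_cases j
    · exact hx
    · exact hy
  simpa [EuclideanSpace.inner_eq_star_dotProduct] using hle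

end Matrices

end Tensor

theorem exists_norm_le_of_forall_mem_convexHull {ι F : Type*} [Finite ι] {E : ι → Type*}
    [∀ i, AddCommGroup (E i)] [∀ i, Module ℝ (E i)] [SeminormedAddCommGroup F] [NormedSpace ℝ F]
    (f : MultilinearMap ℝ E F) {S : ∀ i, Set (E i)} {x : ∀ i, E i}
    (hx : ∀ i, x i ∈ convexHull ℝ (S i)) : ∃ y, (∀ i, y i ∈ S i) ∧ ‖f x‖ ≤ ‖f y‖ := by
  classical
  have := Fintype.ofFinite ι
  suffices h : ∀ J : Finset ι, ∃ y, (∀ i ∈ J, y i ∈ S i) ∧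
      (∀ i, y i ∈ convexHull ℝ (S i)) ∧ ‖f x‖ ≤ ‖f y‖ by
    obtain ⟨y, hy, -, hle⟩ := h Finset.univ
    exact ⟨y, fun i => hy i (Finset.mem_univ i), hle⟩
  intro J
  induction J using Finset.induction_on with
  | empty => exact ⟨x, by simp, hx, le_rfl⟩
  | insert j J hj ih =>
    obtain ⟨y, hyJ, hy, hle⟩ := ih
    have hconv : ConvexOn ℝ Set.univ fun v => ‖f.toLinearMap y j v‖ :=
      (convexOn_univ_norm (E := F)).comp_linearMap (f.toLinearMap y j)
    obtain ⟨v, hv, hyv⟩ := hconv.exists_ge_of_mem_convexHull (Set.subset_univ (S j)) (hy j)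
    simp only [MultilinearMap.toLinearMap_apply, Function.update_eq_self] at hyv
    refine ⟨Function.update y j v, fun i hi => ?_, fun i => ?_, hle.trans hyv⟩
    · rcases eq_or_ne i j with rfl | hij
      · simpa using hv
      · rw [Function.update_of_ne hij]
        exact hyJ i ((Finset.mem_insert.1 hi).resolve_left hij)
    · rcases eq_or_ne i j with rfl | hij
      · simpa using subset_convexHull ℝ (S i) hv
      · rw [Function.update_of_ne hij]
        exact hy i

section DyadicNet

variable {n m : ℕ}

/-- The real numbers `0` and `± 2 ^ (-k)` for `k < m`: the entries of the vectors of `dyadicNet`. -/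
noncomputable def dyadic (m : ℕ) : Finset ℝ :=
  insert 0 ((Finset.range m).image (fun k => (1 / 2 : ℝ) ^ k) ∪
    (Finset.range m).image (fun k => -(1 / 2 : ℝ) ^ k))

theorem mem_dyadic {y : ℝ} : y ∈ dyadic m ↔ y = 0 ∨ ∃ k < m, |y| = (1 / 2 : ℝ) ^ k := by
  simp only [dyadic, Finset.mem_insert, Finset.mem_union, Finset.mem_image, Finset.mem_range]
  refine or_congr_right ⟨?_, ?_⟩
  · rintro (⟨k, hk, rfl⟩ | ⟨k, hk, rfl⟩) <;> exact ⟨k, hk, by simp⟩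
  · rintro ⟨k, hk, h⟩
    rcases (abs_eq (by positivity)).1 h with h | h
    · exact Or.inl ⟨k, hk, h.symm⟩
    · exact Or.inr ⟨k, hk, h.symm⟩

theorem zero_mem_dyadic : (0 : ℝ) ∈ dyadic m := mem_dyadic.2 (Or.inl rfl)

theorem half_pow_mem_dyadic {k : ℕ} (hk : k < m) : (1 / 2 : ℝ) ^ k ∈ dyadic m :=
  mem_dyadic.2 (Or.inr ⟨k, hk, abs_of_pos (by positivity)⟩)

theorem neg_mem_dyadic {y : ℝ} (hy : y ∈ dyadic m) : -y ∈ dyadic m := by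
  simpa [mem_dyadic] using hy

theorem half_pow_sq (k : ℕ) : ((1 / 2 : ℝ) ^ k) ^ 2 = (1 / 4) ^ k := by
  rw [pow_right_comm]
  norm_num

theorem quarter_pow_le_sq_of_mem_dyadic {y : ℝ} (hy : y ∈ dyadic (m + 1)) (hy0 : y ≠ 0) :
    (1 / 4 : ℝ) ^ m ≤ y ^ 2 := by
  obtain ⟨k, hk, hyk⟩ := (mem_dyadic.1 hy).resolve_left hy0
  rw [← sq_abs, hyk, half_pow_sq]
  exact pow_le_pow_of_le_one (by norm_num) (by norm_num) (Nat.le_of_lt_succ hk)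

theorem card_dyadic_erase_zero_le (m : ℕ) : ((dyadic m).erase 0).card ≤ 2 * m := by
  refine (Finset.card_le_card (Finset.erase_insert_subset _ _)).trans
    ((Finset.card_union_le _ _).trans ?_)
  rw [two_mul]
  exact add_le_add (Finset.card_image_le.trans_eq (Finset.card_range m))
    (Finset.card_image_le.trans_eq (Finset.card_range m))

theorem exists_dyadic_le_le (m : ℕ) {y : ℝ} (h0 : 0 ≤ y) (h1 : y ≤ 1) :
    ∃ a ∈ dyadic (m + 1), ∃ b ∈ dyadic (m + 1), 0 ≤ a ∧ a ≤ y ∧ y ≤ b ∧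
      b ^ 2 ≤ 4 * y ^ 2 + (1 / 4) ^ m := by
  rcases le_or_gt y ((1 / 2) ^ m) with hsmall | hlarge
  · refine ⟨0, zero_mem_dyadic, _, half_pow_mem_dyadic m.lt_succ_self, le_rfl, h0, hsmall, ?_⟩
    rw [half_pow_sq]
    nlinarith [sq_nonneg y]
  · obtain ⟨k, hlt, hle⟩ := exists_nat_pow_near_of_lt_one
      ((by positivity : (0 : ℝ) < (1 / 2) ^ m).trans hlarge) h1
      (by norm_num : (0 : ℝ) < 1 / 2) (by norm_num)
    have hkm : k < m :=
      (pow_lt_pow_iff_right_of_lt_one₀ (by norm_num) (by norm_num)).1 (hlarge.trans_le hle)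
    refine ⟨_, half_pow_mem_dyadic (Nat.succ_lt_succ hkm), _,
      half_pow_mem_dyadic (hkm.trans m.lt_succ_self), by positivity, hlt.le, hle, ?_⟩
    have hdouble : (1 / 2 : ℝ) ^ k ≤ 2 * y := by rw [pow_succ] at hlt; linarith
    calc ((1 / 2 : ℝ) ^ k) ^ 2 ≤ (2 * y) ^ 2 := by gcongr
      _ = 4 * y ^ 2 := by ring
      _ ≤ 4 * y ^ 2 + (1 / 4) ^ m := le_add_of_nonneg_right (by positivity)

theorem exists_dyadic_segment (m : ℕ) {y : ℝ} (hy : |y| ≤ 1) :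
    ∃ a b : ℝ, y ∈ segment ℝ a b ∧ ∀ z ∈ ({a, b} : Set ℝ),
      z ∈ dyadic (m + 1) ∧ z ^ 2 ≤ 4 * y ^ 2 + (1 / 4) ^ m := by
  obtain ⟨a, ha, b, hb, ha0, hay, hyb, hsq⟩ := exists_dyadic_le_le m (abs_nonneg y) hy
  rw [sq_abs] at hsq
  have hsq' : a ^ 2 ≤ 4 * y ^ 2 + (1 / 4) ^ m := (by gcongr; linarith : a ^ 2 ≤ b ^ 2).trans hsq
  rcases le_total 0 y with h0 | h0
  · rw [abs_of_nonneg h0] at hay hyb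
    refine ⟨a, b, ?_, ?_⟩
    · rw [segment_eq_Icc (hay.trans hyb)]
      exact ⟨hay, hyb⟩
    · rintro z (rfl | rfl)
      exacts [⟨ha, hsq'⟩, ⟨hb, hsq⟩]
  · rw [abs_of_nonpos h0] at hay hyb
    refine ⟨-b, -a, ?_, ?_⟩
    · rw [segment_eq_Icc (by linarith)]
      exact ⟨by linarith, by linarith⟩
    · rintro z (rfl | rfl)
      exacts [⟨neg_mem_dyadic hb, by rwa [neg_sq]⟩, ⟨neg_mem_dyadic ha, by rwa [neg_sq]⟩]

/-- The vectors with entries in `dyadic m` and Euclidean norm at most `√5`; the radius leaves room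
for rounding the entries of a unit vector to dyadic numbers. -/
noncomputable def dyadicNet (n m : ℕ) : Finset (Fin n → ℝ) :=
  (Fintype.piFinset fun _ => dyadic m).filter fun x => ∑ k, x k ^ 2 ≤ 5

theorem mem_dyadicNet {x : Fin n → ℝ} :
    x ∈ dyadicNet n m ↔ (∀ k, x k ∈ dyadic m) ∧ ∑ k, x k ^ 2 ≤ 5 := by
  simp [dyadicNet, Fintype.mem_piFinset]

theorem mem_convexHull_dyadicNet (hm : (n : ℝ) * (1 / 4) ^ m ≤ 1) {x : Fin n → ℝ}
    (hx : ∑ k, x k ^ 2 ≤ 1) : x ∈ convexHull ℝ (dyadicNet n (m + 1) : Set (Fin n → ℝ)) := by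
  have habs (k : Fin n) : |x k| ≤ 1 := by
    rw [← sq_le_one_iff_abs_le_one]
    exact (Finset.single_le_sum (f := fun k => x k ^ 2) (fun _ _ => sq_nonneg _)
      (Finset.mem_univ k)).trans hx
  choose a b hseg hdyadic using fun k => exists_dyadic_segment m (habs k)
  have hbox : x ∈ convexHull ℝ (Set.univ.pi fun k => ({a k, b k} : Set ℝ)) :=
    mem_convexHull_pi fun k _ => by rw [convexHull_pair]; exact hseg k
  refine convexHull_mono (fun z hz => ?_) hbox
  have hz' (k) := hdyadic k (z k) (hz k trivial)
  refine mem_dyadicNet.2 ⟨fun k => (hz' k).1, ?_⟩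
  calc ∑ k, z k ^ 2 ≤ ∑ k, (4 * x k ^ 2 + (1 / 4) ^ m) :=
        Finset.sum_le_sum fun k _ => (hz' k).2
    _ = 4 * ∑ k, x k ^ 2 + n * (1 / 4) ^ m := by
        rw [Finset.sum_add_distrib, ← Finset.mul_sum]; simp
    _ ≤ 5 := by linarith

theorem card_piFinset_filter_sum_sq_le {ι : Type*} [Fintype ι] [DecidableEq ι] (S : Finset ℝ)
    {β : ℝ} (hβ : 0 ≤ β) (R : ℝ) :
    (((Fintype.piFinset fun _ : ι => S).filter fun x => ∑ k, x k ^ 2 ≤ R).card : ℝ) ≤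
      Real.exp (β * R) * (∑ y ∈ S, Real.exp (-(β * y ^ 2))) ^ Fintype.card ι := by
  rw [← Finset.card_univ, ← Finset.prod_const, Finset.prod_univ_sum, Finset.mul_sum,
    ← nsmul_one]
  refine (Finset.card_nsmul_le_sum _ _ _ fun x hx => ?_).trans
    (Finset.sum_le_sum_of_subset_of_nonneg (Finset.filter_subset _ _) fun _ _ _ => by positivity)
  rw [← Real.exp_sum, ← Real.exp_add, Real.one_le_exp_iff, Finset.sum_neg_distrib,
    ← Finset.mul_sum, ← sub_eq_add_neg, ← mul_sub]
  exact mul_nonneg hβ (sub_nonneg.2 (Finset.mem_filter.1 hx).2)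

theorem sum_dyadic_exp_le (m : ℕ) {L : ℝ} (hL : 0 ≤ L) :
    ∑ y ∈ dyadic (m + 1), Real.exp (-(4 ^ m * L * y ^ 2)) ≤
      Real.exp (2 * 4 ^ m * Real.exp (-L)) := by
  have hterm (y) (hy : y ∈ (dyadic (m + 1)).erase 0) :
      Real.exp (-(4 ^ m * L * y ^ 2)) ≤ Real.exp (-L) := by
    rw [Finset.mem_erase] at hy
    rw [Real.exp_le_exp, neg_le_neg_iff]
    calc L = 4 ^ m * L * (1 / 4) ^ m := by rw [mul_right_comm, ← mul_pow]; norm_num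
      _ ≤ 4 ^ m * L * y ^ 2 := by gcongr; exact quarter_pow_le_sq_of_mem_dyadic hy.2 hy.1
  have hcard : (((dyadic (m + 1)).erase 0).card : ℝ) ≤ 2 * 4 ^ m := by
    have hpow : m + 1 ≤ 4 ^ m := Nat.lt_pow_self (by norm_num)
    exact_mod_cast (card_dyadic_erase_zero_le (m + 1)).trans (Nat.mul_le_mul_left 2 hpow)
  rw [← Finset.add_sum_erase _ _ zero_mem_dyadic]
  calc Real.exp (-(4 ^ m * L * 0 ^ 2)) +
        ∑ y ∈ (dyadic (m + 1)).erase 0, Real.exp (-(4 ^ m * L * y ^ 2))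
      ≤ 1 + ((dyadic (m + 1)).erase 0).card * Real.exp (-L) := by
        gcongr
        · simp
        · simpa using Finset.sum_le_card_nsmul _ _ _ hterm
    _ ≤ 2 * 4 ^ m * Real.exp (-L) + 1 := by rw [add_comm]; gcongr
    _ ≤ Real.exp (2 * 4 ^ m * Real.exp (-L)) := Real.add_one_le_exp _

theorem two_thirds_le_log (hn : 2 ≤ n) : 2 / 3 ≤ Real.log n :=
  (by linarith [Real.log_two_gt_d9] : 2 / 3 ≤ Real.log 2).trans
    (Real.log_le_log two_pos (by exact_mod_cast hn))

theorem card_dyadicNet_le (hn : 2 ≤ n) (m : ℕ) :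
    ((dyadicNet n (m + 1)).card : ℝ) ≤ Real.exp (4 ^ m * (8 * Real.log n)) := by
  have hn0 : (0 : ℝ) < n := by positivity
  have hlog := two_thirds_le_log hn
  have hsum := sum_dyadic_exp_le m (by linarith : 0 ≤ Real.log n)
  rw [Real.exp_neg, Real.exp_log hn0] at hsum
  calc ((dyadicNet n (m + 1)).card : ℝ)
      ≤ Real.exp (4 ^ m * Real.log n * 5) *
          (∑ y ∈ dyadic (m + 1), Real.exp (-(4 ^ m * Real.log n * y ^ 2))) ^ n := by
        simpa [dyadicNet] using card_piFinset_filter_sum_sq_le (ι := Fin n) (dyadic (m + 1))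
          (by positivity : 0 ≤ 4 ^ m * Real.log n) 5
    _ ≤ Real.exp (4 ^ m * Real.log n * 5) * Real.exp (2 * 4 ^ m * (n : ℝ)⁻¹) ^ n := by gcongr
    _ = Real.exp (4 ^ m * (5 * Real.log n + 2)) := by
        rw [← Real.exp_nat_mul, ← Real.exp_add]
        congr 1
        field_simp
    _ ≤ Real.exp (4 ^ m * (8 * Real.log n)) := by gcongr; linarith

end DyadicNet

theorem sum_prod_ne_mul_le {ι κ : Type*} [Fintype ι] [DecidableEq ι] [Fintype κ] (J : ι)
    {f : ι → κ → ℝ} (hf : ∀ j k, 0 ≤ f j k) {w : (ι → κ) → ℝ} {r : ℝ} (hr : 0 ≤ r)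
    (hw : ∀ i, ∑ k, w (Function.update i J k) ≤ r) :
    ∑ i : ι → κ, (∏ j : {j // j ≠ J}, f j (i j)) * w i ≤
      (∏ j : {j // j ≠ J}, ∑ k, f j k) * r := by
  let split := Equiv.funSplitAt J κ
  have hfibre (g : {j // j ≠ J} → κ) : ∑ k, w (split.symm (k, g)) ≤ r := by
    rcases isEmpty_or_nonempty κ with _ | ⟨⟨k₀⟩⟩
    · simpa using hr
    · convert hw (split.symm (k₀, g)) using 3 with k
      ext j
      by_cases hj : j = J
      · subst hj; simp [split, Equiv.funSplitAt, Equiv.piSplitAt]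
      · simp [split, Equiv.funSplitAt, Equiv.piSplitAt, hj]
  have hsplit (k : κ) (g : {j // j ≠ J} → κ) (j : {j // j ≠ J}) : split.symm (k, g) j = g j := by
    simp [split, Equiv.funSplitAt, Equiv.piSplitAt, j.2]
  rw [← split.symm.sum_comp, Fintype.sum_prod_type_right, Fintype.prod_sum, Finset.sum_mul]
  simp only [hsplit, ← Finset.mul_sum]
  gcongr with g
  · exact Finset.prod_nonneg fun j _ => hf j _
  · exact hfibre g

namespace Tensor

section LevelDecomposition

variable {d n : ℕ}

/-- Replaces the entries of absolute value `2 ^ (-m)` by zero; on `dyadicNet n (m + 1)` these are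
the smallest nonzero entries. -/
noncomputable def dropLevel (m : ℕ) (x : Fin n → ℝ) : Fin n → ℝ :=
  fun k => if |x k| = (1 / 2 : ℝ) ^ m then 0 else x k

/-- The coefficients of the part of the contraction that is lost under `dropLevel m`: they vanish
unless one of the factors has absolute value `2 ^ (-m)`. -/
noncomputable def levelCoeff (m : ℕ) (x : Fin d → Fin n → ℝ) (i : Fin d → Fin n) : ℝ :=
  ∏ j, x j (i j) - ∏ j, dropLevel m (x j) (i j)

theorem dropLevel_mem_dyadicNet {m : ℕ} {x : Fin n → ℝ} (hx : x ∈ dyadicNet n (m + 1)) :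
    dropLevel m x ∈ dyadicNet n m := by
  rw [mem_dyadicNet] at hx ⊢
  refine ⟨fun k => ?_, (Finset.sum_le_sum fun k _ => ?_).trans hx.2⟩
  · unfold dropLevel
    split_ifs with hk
    · exact zero_mem_dyadic
    · refine mem_dyadic.2 ((mem_dyadic.1 (hx.1 k)).imp_right ?_)
      rintro ⟨l, hl, hxl⟩
      refine ⟨l, lt_of_le_of_ne (Nat.le_of_lt_succ hl) ?_, hxl⟩
      rintro rfl
      exact hk hxl
  · unfold dropLevel
    split_ifs
    · rw [zero_pow two_ne_zero]
      exact sq_nonneg _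
    · exact le_rfl

theorem form_eq_sum_levelCoeff_add (A : Tensor d n) (m : ℕ) (x : Fin d → Fin n → ℝ) :
    A.form x = ∑ i, levelCoeff m x i * A i + A.form fun j => dropLevel m (x j) := by
  simp only [form_apply, ← Finset.sum_add_distrib, levelCoeff]
  exact Finset.sum_congr rfl fun i _ => by ring

theorem levelCoeff_sq_le (m : ℕ) (x : Fin d → Fin n → ℝ) (i : Fin d → Fin n) :
    levelCoeff m x i ^ 2 ≤ ∑ J : Fin d, (1 / 4) ^ m * ∏ j : {j // j ≠ J}, x j (i j) ^ 2 := by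
  have hnonneg (J : Fin d) : 0 ≤ (1 / 4) ^ m * ∏ j : {j // j ≠ J}, x j (i j) ^ 2 := by positivity
  by_cases h : ∃ J, |x J (i J)| = (1 / 2 : ℝ) ^ m
  · obtain ⟨J, hJ⟩ := h
    have hdrop : ∏ j, dropLevel m (x j) (i j) = 0 :=
      Finset.prod_eq_zero (Finset.mem_univ J) (if_pos hJ)
    calc levelCoeff m x i ^ 2 = x J (i J) ^ 2 * ∏ j : {j // j ≠ J}, x j (i j) ^ 2 := by
          rw [levelCoeff, hdrop, sub_zero, ← Finset.prod_pow,
            Fintype.prod_eq_mul_prod_subtype_ne _ J]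
      _ = (1 / 4) ^ m * ∏ j : {j // j ≠ J}, x j (i j) ^ 2 := by
          rw [← sq_abs (x J (i J)), hJ, half_pow_sq]
      _ ≤ _ := Finset.single_le_sum (fun J _ => hnonneg J) (Finset.mem_univ J)
  · push Not at h
    have hzero : levelCoeff m x i = 0 := by
      rw [levelCoeff, sub_eq_zero]
      exact Finset.prod_congr rfl fun j _ => (if_neg (h j)).symm
    rw [hzero, zero_pow two_ne_zero]
    exact Finset.sum_nonneg fun J _ => hnonneg J

theorem sum_levelCoeff_sq_mul_le (m : ℕ) {x : Fin d → Fin n → ℝ} (hx : ∀ j, ∑ k, x j k ^ 2 ≤ 5)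
    {w : Tensor d n} (hw : ∀ i, 0 ≤ w i) {r : ℝ} (hr : 0 ≤ r)
    (hfibre : ∀ J i, ∑ k, w (Function.update i J k) ≤ r) :
    ∑ i, levelCoeff m x i ^ 2 * w i ≤ d * ((1 / 4) ^ m * 5 ^ d * r) := by
  have hmode (J : Fin d) :
      ∑ i, (∏ j : {j // j ≠ J}, x j (i j) ^ 2) * w i ≤ 5 ^ d * r := by
    refine (sum_prod_ne_mul_le J (fun j k => sq_nonneg (x j k)) hr (hfibre J)).trans ?_
    gcongr
    calc ∏ j : {j // j ≠ J}, ∑ k, x j k ^ 2 ≤ ∏ _j : {j // j ≠ J}, 5 :=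
          Finset.prod_le_prod (fun j _ => Finset.sum_nonneg fun k _ => sq_nonneg _)
            fun j _ => hx j
      _ = 5 ^ (d - 1) := by simp
      _ ≤ 5 ^ d := pow_le_pow_right₀ (by norm_num) (Nat.sub_le d 1)
  calc ∑ i, levelCoeff m x i ^ 2 * w i
      ≤ ∑ i, (∑ J : Fin d, (1 / 4) ^ m * ∏ j : {j // j ≠ J}, x j (i j) ^ 2) * w i :=
        Finset.sum_le_sum fun i _ => mul_le_mul_of_nonneg_right (levelCoeff_sq_le m x i) (hw i)
    _ = ∑ J : Fin d, (1 / 4) ^ m * ∑ i, (∏ j : {j // j ≠ J}, x j (i j) ^ 2) * w i := by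
        simp only [Finset.sum_mul, Finset.mul_sum, mul_assoc]
        exact Finset.sum_comm
    _ ≤ ∑ _J : Fin d, (1 / 4) ^ m * (5 ^ d * r) :=
        Finset.sum_le_sum fun J _ => mul_le_mul_of_nonneg_left (hmode J) (by positivity)
    _ = d * ((1 / 4) ^ m * 5 ^ d * r) := by simp [mul_assoc]

theorem abs_form_le_of_abs_sum_levelCoeff_le (hd : 0 < d) {A : Tensor d n} {t : ℝ} {M : ℕ}
    (h : ∀ m < M, ∀ x : Fin d → Fin n → ℝ, (∀ j, x j ∈ dyadicNet n (m + 1)) →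
      |∑ i, levelCoeff m x i * A i| ≤ t)
    {x : Fin d → Fin n → ℝ} (hx : ∀ j, x j ∈ dyadicNet n M) : |A.form x| ≤ M * t := by
  induction M generalizing x with
  | zero =>
    have hzero : x ⟨0, hd⟩ = 0 := by
      funext k
      simpa [mem_dyadic] using (mem_dyadicNet.1 (hx ⟨0, hd⟩)).1 k
    simp [A.form.map_coord_zero ⟨0, hd⟩ hzero]
  | succ M ih =>
    have hlevel := h M M.lt_succ_self x hx
    have hrest := ih (fun m hm => h m (hm.trans M.lt_succ_self))
      fun j => dropLevel_mem_dyadicNet (hx j)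
    rw [form_eq_sum_levelCoeff_add A M x]
    push_cast
    linarith [abs_add_le (∑ i, levelCoeff M x i * A i) (A.form fun j => dropLevel M (x j))]

theorem spectralNorm_le_of_abs_sum_levelCoeff_le (hd : 0 < d) {A : Tensor d n} {t : ℝ} (ht : 0 ≤ t)
    {M : ℕ} (hM : (n : ℝ) * (1 / 4) ^ M ≤ 1)
    (h : ∀ m < M + 1, ∀ x : Fin d → Fin n → ℝ, (∀ j, x j ∈ dyadicNet n (m + 1)) →
      |∑ i, levelCoeff m x i * A i| ≤ t) :
    A.spectralNorm ≤ (M + 1 : ℕ) * t := by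
  refine spectralNorm_le_of_abs_form_le (by positivity) fun x hx => ?_
  obtain ⟨y, hy, hle⟩ := exists_norm_le_of_forall_mem_convexHull A.form
    fun j => mem_convexHull_dyadicNet hM (hx j)
  exact hle.trans (abs_form_le_of_abs_sum_levelCoeff_le hd h hy)

end LevelDecomposition

end Tensor

section BoundedNoise

open ProbabilityTheory

variable {Ω ι κ : Type*} [MeasurableSpace Ω] {P : Measure Ω} {X : ι → Ω → ℝ} {v b : ℝ}

/-- A family of independent centred random variables whose variances are at most `v` and whose
squares are almost surely at most `b`: the entries of the random part of the sparsification
error. -/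
structure IsBoundedNoise (X : ι → Ω → ℝ) (P : Measure Ω) (v b : ℝ) : Prop where
  measurable : ∀ i, Measurable (X i)
  indep : iIndepFun X P
  integral_eq_zero : ∀ i, ∫ ω, X i ω ∂P = 0
  integral_sq_le : ∀ i, ∫ ω, X i ω ^ 2 ∂P ≤ v
  sq_le : ∀ i, ∀ᵐ ω ∂P, X i ω ^ 2 ≤ b

namespace IsBoundedNoise

theorem comp_injective (hX : IsBoundedNoise X P v b) {g : κ → ι} (hg : g.Injective) :
    IsBoundedNoise (fun k => X (g k)) P v b where
  measurable k := hX.measurable (g k)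
  indep := hX.indep.precomp hg
  integral_eq_zero k := hX.integral_eq_zero (g k)
  integral_sq_le k := hX.integral_sq_le (g k)
  sq_le k := hX.sq_le (g k)

theorem var_nonneg (hX : IsBoundedNoise X P v b) (i : ι) : 0 ≤ v :=
  (integral_nonneg fun _ => sq_nonneg _).trans (hX.integral_sq_le i)

theorem bound_nonneg (hX : IsBoundedNoise X P v b) (i : ι) : 0 ≤ b := by
  have := hX.indep.isProbabilityMeasure
  obtain ⟨ω, hω⟩ := (hX.sq_le i).exists
  exact (sq_nonneg _).trans hω

theorem memLp_two (hX : IsBoundedNoise X P v b) (i : ι) : MemLp (X i) 2 P := by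
  have := hX.indep.isProbabilityMeasure
  exact .of_bound (hX.measurable i).aestronglyMeasurable √b <|
    (hX.sq_le i).mono fun ω hω => Real.abs_le_sqrt hω

theorem measureReal_sum_sq_gt_le [Fintype ι] (hX : IsBoundedNoise X P v b) (hb : 0 ≤ b) (u : ℝ) :
    P.real {ω | 2 * Fintype.card ι * v + b * u < ∑ i, X i ω ^ 2} ≤ Real.exp (-u) := by
  have := hX.indep.isProbabilityMeasure
  have hvar : ∑ i, ∫ ω, X i ω ^ 2 ∂P ≤ Fintype.card ι * v := by
    simpa using Finset.sum_le_card_nsmul Finset.univ _ v fun i _ => hX.integral_sq_le i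
  refine (measureReal_mono fun ω hω => ?_).trans
    (measureReal_sum_gt_le_exp_neg (hX.indep.comp (fun _ x => x ^ 2) fun _ => by fun_prop)
      (fun i => (hX.measurable i).pow_const 2) hb (fun i => .of_forall fun ω => sq_nonneg (X i ω))
      hX.sq_le u)
  have hω' : 2 * Fintype.card ι * v + b * u < ∑ i, X i ω ^ 2 := hω
  change 2 * ∑ i, ∫ ω, X i ω ^ 2 ∂P + b * u < ∑ i, X i ω ^ 2
  linarith

theorem measureReal_abs_sum_mul_gt_le [Fintype ι] (hX : IsBoundedNoise X P v b) (c : ι → ℝ)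
    {V u : ℝ} (hV : 0 ≤ V) (hvar : ∑ i, c i ^ 2 * v ≤ V) (hu : 0 ≤ u) :
    P.real {ω | √(8 * V * u) < |∑ i, c i * X i ω| ∧ ∑ i, c i ^ 2 * X i ω ^ 2 ≤ V} ≤
      2 * Real.exp (-u) := by
  have htail := measureReal_abs_sum_gt_and_sum_sq_le_le_exp_neg (X := fun i ω => c i * X i ω)
    (hX.indep.comp (fun i x => c i * x) fun _ => by fun_prop)
    (fun i => (hX.measurable i).const_mul (c i)) (fun i => (hX.memLp_two i).const_mul (c i))
    (fun i => by rw [integral_const_mul, hX.integral_eq_zero, mul_zero]) hV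
    (by
      simp only [mul_pow, integral_const_mul]
      exact (Finset.sum_le_sum fun i _ =>
        mul_le_mul_of_nonneg_left (hX.integral_sq_le i) (sq_nonneg (c i))).trans hvar) hu
  simpa only [mul_pow] using htail

end IsBoundedNoise

end BoundedNoise

theorem one_sub_le_measureReal {Ω : Type*} [MeasurableSpace Ω] {P : Measure Ω}
    [IsProbabilityMeasure P] {S B : Set Ω} {δ : ℝ} (hB : P.real B ≤ δ) (h : Bᶜ ⊆ S) :
    1 - δ ≤ P.real S := by
  have hcover : (1 : ℝ) ≤ P.real (B ∪ S) := by
    rw [← probReal_univ (μ := P), ← Set.compl_subset_iff_union.1 h]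
  linarith [measureReal_union_le (μ := P) B S]

namespace Tensor

section RandomTensor

variable {d n : ℕ} {Ω : Type*} [MeasurableSpace Ω] {P : Measure Ω}
  {X : (Fin d → Fin n) → Ω → ℝ} {v b r : ℝ}

theorem measureReal_exists_fibre_gt_le (hX : IsBoundedNoise X P v b) (u : ℝ) :
    P.real {ω | ∃ J i, 2 * n * v + b * u < ∑ k, X (Function.update i J k) ω ^ 2} ≤
      d * n ^ d * Real.exp (-u) := by
  have hfibre (p : Fin d × (Fin d → Fin n)) : P.real
      {ω | 2 * n * v + b * u < ∑ k, X (Function.update p.2 p.1 k) ω ^ 2} ≤ Real.exp (-u) := by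
    simpa using (hX.comp_injective (Function.update_injective p.2 p.1)).measureReal_sum_sq_gt_le
      (hX.bound_nonneg p.2) u
  calc P.real {ω | ∃ J i, 2 * n * v + b * u < ∑ k, X (Function.update i J k) ω ^ 2}
      = P.real (⋃ p : Fin d × (Fin d → Fin n),
          {ω | 2 * n * v + b * u < ∑ k, X (Function.update p.2 p.1 k) ω ^ 2}) := by
        congr 1
        ext ω
        simp
    _ ≤ ∑ _p : Fin d × (Fin d → Fin n), Real.exp (-u) :=
        (measureReal_iUnion_fintype_le _).trans (Finset.sum_le_sum fun p _ => hfibre p)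
    _ = d * n ^ d * Real.exp (-u) := by simp

theorem measureReal_abs_sum_levelCoeff_gt_le (hX : IsBoundedNoise X P v b) (hv : 0 ≤ v)
    (hr : n * v ≤ r) (m : ℕ) {x : Fin d → Fin n → ℝ} (hx : ∀ j, ∑ k, x j k ^ 2 ≤ 5) {u : ℝ}
    (hu : 0 ≤ u) :
    P.real {ω | √(8 * (d * ((1 / 4) ^ m * 5 ^ d * r)) * u) < |∑ i, levelCoeff m x i * X i ω| ∧
      ∀ J i, ∑ k, X (Function.update i J k) ω ^ 2 ≤ r} ≤ 2 * Real.exp (-u) := by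
  have := hX.indep.isProbabilityMeasure
  have hr0 : 0 ≤ r := (by positivity : 0 ≤ n * v).trans hr
  refine (measureReal_mono ?_).trans
    (hX.measureReal_abs_sum_mul_gt_le (levelCoeff m x) (by positivity)
      (sum_levelCoeff_sq_mul_le m hx (fun _ => hv) hr0 fun _ _ => by simpa using hr) hu)
  rintro ω ⟨hlt, hfibre⟩
  exact ⟨hlt, sum_levelCoeff_sq_mul_le m hx (fun i => sq_nonneg (X i ω)) hr0 hfibre⟩

/-- With probability at least `1 - O(n ^ (-4))` no level of the contraction of a random tensor
exceeds `levelDeviation d n r`, as long as the sums of squares along its fibres are at most `r`.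
The factor `96` is `8 * 12`: the `8` is that of the tail bound, and a tail exponent of
`12 * 4 ^ m * d * log n` beats the `exp (8 * 4 ^ m * d * log n)` tuples of net vectors. -/
noncomputable def levelDeviation (d n : ℕ) (r : ℝ) : ℝ := √(96 * 5 ^ d * d ^ 2 * r * Real.log n)

theorem card_piFinset_dyadicNet_mul_exp_neg_le (hn : 2 ≤ n) (hd : 0 < d) (m : ℕ) :
    (Fintype.piFinset fun _ : Fin d => dyadicNet n (m + 1)).card *
      Real.exp (-(4 ^ m * (12 * d * Real.log n))) ≤ 1 / (n : ℝ) ^ 4 := by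
  have hn0 : (0 : ℝ) < n := by positivity
  have hL : 2 / 3 ≤ Real.log n := two_thirds_le_log hn
  have hd1 : (1 : ℝ) ≤ d := by exact_mod_cast hd
  have h4 : (1 : ℝ) ≤ 4 ^ m := one_le_pow₀ (by norm_num)
  rw [Fintype.card_piFinset_const, Nat.cast_pow]
  calc ((dyadicNet n (m + 1)).card : ℝ) ^ d * Real.exp (-(4 ^ m * (12 * d * Real.log n)))
      ≤ Real.exp (4 ^ m * (8 * Real.log n)) ^ d *
          Real.exp (-(4 ^ m * (12 * d * Real.log n))) := by
        gcongr
        exact card_dyadicNet_le hn m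
    _ = Real.exp (-(4 ^ m * d * (4 * Real.log n))) := by
        rw [← Real.exp_nat_mul, ← Real.exp_add]
        ring_nf
    _ ≤ Real.exp (-(4 * Real.log n)) :=
        Real.exp_le_exp.2 <| neg_le_neg <| le_mul_of_one_le_left (by linarith)
          (one_le_mul_of_one_le_of_one_le h4 hd1)
    _ = 1 / (n : ℝ) ^ 4 := by
        rw [Real.exp_neg, mul_comm 4, Real.exp_mul, Real.exp_log hn0, one_div]
        norm_cast

theorem measureReal_exists_abs_sum_levelCoeff_gt_le (hn : 2 ≤ n) (hd : 0 < d)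
    (hX : IsBoundedNoise X P v b) (hv : 0 ≤ v) (hr : n * v ≤ r) (m : ℕ) :
    P.real {ω | (∃ x : Fin d → Fin n → ℝ, (∀ j, x j ∈ dyadicNet n (m + 1)) ∧
        levelDeviation d n r < |∑ i, levelCoeff m x i * X i ω|) ∧
      ∀ J i, ∑ k, X (Function.update i J k) ω ^ 2 ≤ r} ≤ 2 / (n : ℝ) ^ 4 := by
  have := hX.indep.isProbabilityMeasure
  have hL : 2 / 3 ≤ Real.log n := two_thirds_le_log hn
  let u : ℝ := 4 ^ m * (12 * d * Real.log n)
  have hdev : levelDeviation d n r = √(8 * (d * ((1 / 4) ^ m * 5 ^ d * r)) * u) := by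
    rw [levelDeviation, one_div_pow]
    congr 1
    field_simp
    ring
  let F := Fintype.piFinset fun _ : Fin d => dyadicNet n (m + 1)
  let S (x : Fin d → Fin n → ℝ) : Set Ω :=
    {ω | levelDeviation d n r < |∑ i, levelCoeff m x i * X i ω| ∧
      ∀ J i, ∑ k, X (Function.update i J k) ω ^ 2 ≤ r}
  have hS (x) (hx : x ∈ F) : P.real (S x) ≤ 2 * Real.exp (-u) := by
    simp only [S, hdev]
    exact measureReal_abs_sum_levelCoeff_gt_le hX hv hr m
      (fun j => (mem_dyadicNet.1 (Fintype.mem_piFinset.1 hx j)).2) (by positivity)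
  calc _ ≤ P.real (⋃ x ∈ F, S x) := by
        refine measureReal_mono ?_ (measure_ne_top _ _)
        rintro ω ⟨⟨x, hx, hlt⟩, hfibre⟩
        exact Set.mem_biUnion (Finset.mem_coe.2 (Fintype.mem_piFinset.2 hx)) ⟨hlt, hfibre⟩
    _ ≤ F.card * (2 * Real.exp (-u)) := by
        rw [← nsmul_eq_mul]
        exact (measureReal_biUnion_finset_le _ _).trans (Finset.sum_le_card_nsmul _ _ _ hS)
    _ = 2 * (F.card * Real.exp (-u)) := mul_left_comm _ _ _
    _ ≤ 2 * (1 / (n : ℝ) ^ 4) := by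
        gcongr
        exact card_piFinset_dyadicNet_mul_exp_neg_le hn hd m
    _ = 2 / (n : ℝ) ^ 4 := mul_one_div _ _

theorem exists_level_count (hn : 2 ≤ n) : ∃ M : ℕ, (n : ℝ) * (1 / 4) ^ M ≤ 1 ∧
    ((M + 1 : ℕ) : ℝ) ≤ n ∧ ((M + 1 : ℕ) : ℝ) ≤ 4 * Real.log n := by
  have hn0 : (0 : ℝ) < n := by positivity
  have hL : 2 / 3 ≤ Real.log n := two_thirds_le_log hn
  have hceil : (⌈Real.log n⌉₊ : ℝ) < Real.log n + 1 := Nat.ceil_lt_add_one (by linarith)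
  refine ⟨⌈Real.log n⌉₊, ?_, ?_, ?_⟩
  · rw [one_div_pow, mul_one_div, div_le_one (by positivity)]
    calc (n : ℝ) = Real.exp (Real.log n) := (Real.exp_log hn0).symm
      _ ≤ Real.exp (⌈Real.log n⌉₊ : ℝ) := Real.exp_le_exp.2 (Nat.le_ceil _)
      _ = Real.exp 1 ^ ⌈Real.log n⌉₊ := by rw [← Real.exp_nat_mul, mul_one]
      _ ≤ 4 ^ ⌈Real.log n⌉₊ := by gcongr; linarith [Real.exp_one_lt_d9]
  · have hlt : (⌈Real.log n⌉₊ : ℝ) < n := hceil.trans_le (by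
      simpa [Real.exp_log hn0] using Real.add_one_le_exp (Real.log n))
    exact_mod_cast hlt
  · push_cast
    linarith

theorem mul_pow_mul_exp_neg_le (hn : 2 ≤ n) (hd : 0 < d) :
    d * (n : ℝ) ^ d * Real.exp (-(5 * d * Real.log n)) ≤ 1 / (n : ℝ) ^ 3 := by
  have hn0 : (0 : ℝ) < n := by positivity
  have hexp : Real.exp (5 * d * Real.log n) = (n : ℝ) ^ (5 * d) := by
    rw [mul_comm, Real.exp_mul, Real.exp_log hn0]
    norm_cast
  have hpow : d * n ^ d * n ^ 3 ≤ n ^ (5 * d) := by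
    calc d * n ^ d * n ^ 3 ≤ n ^ d * n ^ d * n ^ 3 := by
          gcongr
          exact (Nat.lt_pow_self hn).le
      _ = n ^ (d + d + 3) := by rw [pow_add, pow_add]
      _ ≤ n ^ (5 * d) := Nat.pow_le_pow_right (by omega) (by omega)
  rw [Real.exp_neg, hexp, ← div_eq_mul_inv, div_le_div_iff₀ (by positivity) (by positivity),
    one_mul]
  exact_mod_cast hpow

theorem measureReal_exists_fibre_gt_or_exists_level_gt_le (hn : 2 ≤ n) (hd : 0 < d)
    (hX : IsBoundedNoise X P v b) (hv : 0 ≤ v) (hr : n * v ≤ r)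
    (hr' : 2 * n * v + b * (5 * d * Real.log n) ≤ r) {M : ℕ} (hM : (M : ℝ) ≤ n) :
    P.real ({ω | ∃ J i, r < ∑ k, X (Function.update i J k) ω ^ 2} ∪ ⋃ m ∈ Finset.range M,
      {ω | (∃ x : Fin d → Fin n → ℝ, (∀ j, x j ∈ dyadicNet n (m + 1)) ∧
          levelDeviation d n r < |∑ i, levelCoeff m x i * X i ω|) ∧
        ∀ J i, ∑ k, X (Function.update i J k) ω ^ 2 ≤ r}) ≤ 1 / n := by
  have := hX.indep.isProbabilityMeasure
  have hn2 : (2 : ℝ) ≤ n := by exact_mod_cast hn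
  have hfibre : P.real {ω | ∃ J i, r < ∑ k, X (Function.update i J k) ω ^ 2} ≤
      1 / (n : ℝ) ^ 3 := by
    refine (measureReal_mono ?_).trans
      ((measureReal_exists_fibre_gt_le hX (5 * d * Real.log n)).trans
        (mul_pow_mul_exp_neg_le hn hd))
    rintro ω ⟨J, i, hlt⟩
    exact ⟨J, i, hr'.trans_lt hlt⟩
  calc _ ≤ 1 / (n : ℝ) ^ 3 + ∑ _m ∈ Finset.range M, 2 / (n : ℝ) ^ 4 :=
        (measureReal_union_le _ _).trans <| add_le_add hfibre <|
          (measureReal_biUnion_finset_le _ _).trans <| Finset.sum_le_sum fun m _ =>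
            measureReal_exists_abs_sum_levelCoeff_gt_le hn hd hX hv hr m
    _ ≤ 1 / (n : ℝ) ^ 3 + n * (2 / (n : ℝ) ^ 4) := by
        rw [Finset.sum_const, Finset.card_range, nsmul_eq_mul]
        gcongr
    _ = 3 / (n : ℝ) ^ 2 * (1 / n) := by field_simp; norm_num
    _ ≤ 1 / n :=
        mul_le_of_le_one_left (by positivity) ((div_le_one (by positivity)).2 (by nlinarith))

theorem one_sub_le_measureReal_spectralNorm_le (hn : 2 ≤ n) (hd : 0 < d)
    (hX : IsBoundedNoise X P v b) (hr : 2 * n * v + b * (5 * d * Real.log n) ≤ r) :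
    1 - 1 / (n : ℝ) ≤ P.real {ω | spectralNorm (fun i => X i ω) ≤
      4 * Real.log n * levelDeviation d n r} := by
  have := hX.indep.isProbabilityMeasure
  let i₀ : Fin d → Fin n := fun _ => ⟨0, by omega⟩
  have hv : 0 ≤ v := hX.var_nonneg i₀
  have hb : 0 ≤ b := hX.bound_nonneg i₀
  have hL : 2 / 3 ≤ Real.log n := two_thirds_le_log hn
  have hnv : n * v ≤ r := by
    have h1 : 0 ≤ n * v := by positivity
    have h2 : 0 ≤ b * (5 * d * Real.log n) := by positivity
    linarith
  obtain ⟨M, hM, hMn, hML⟩ := exists_level_count hn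
  refine one_sub_le_measureReal
    (measureReal_exists_fibre_gt_or_exists_level_gt_le hn hd hX hv hnv hr hMn) fun ω hω => ?_
  simp only [Set.compl_union, Set.mem_inter_iff, Set.mem_compl_iff, Set.mem_ofPred_eq,
    Set.mem_iUnion, not_exists, not_and, not_lt, Finset.mem_range] at hω
  obtain ⟨hfibre, hlevel⟩ := hω
  calc spectralNorm (fun i => X i ω) ≤ (M + 1 : ℕ) * levelDeviation d n r :=
        spectralNorm_le_of_abs_sum_levelCoeff_le hd (Real.sqrt_nonneg _) hM fun m hm x hx =>
          not_lt.1 fun hlt => hlevel m hm ⟨x, hx, hlt⟩ hfibre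
    _ ≤ 4 * Real.log n * levelDeviation d n r :=
        mul_le_mul_of_nonneg_right hML (Real.sqrt_nonneg _)

end RandomTensor

end Tensor

open ProbabilityTheory in
theorem IsBoundedNoise.pi {ι : Type*} [Fintype ι] {μ : ι → Measure ℝ}
    [∀ i, IsProbabilityMeasure (μ i)] {c : ι → ℝ} {v b : ℝ}
    (hmean : ∀ i, ∫ y, (y - c i) ∂μ i = 0) (hvar : ∀ i, ∫ y, (y - c i) ^ 2 ∂μ i ≤ v)
    (hbound : ∀ i, ∀ᵐ y ∂μ i, (y - c i) ^ 2 ≤ b) :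
    IsBoundedNoise (fun i ω => ω i - c i) (Measure.pi μ) v b where
  measurable i := by fun_prop
  indep := iIndepFun_pi (X := fun i y => y - c i) fun i => by fun_prop
  integral_eq_zero i :=
    (integral_comp_eval (by fun_prop : AEStronglyMeasurable (fun y => y - c i) (μ i))).trans
      (hmean i)
  integral_sq_le i :=
    (integral_comp_eval
      (by fun_prop : AEStronglyMeasurable (fun y => (y - c i) ^ 2) (μ i))).trans_le (hvar i)
  sq_le i := (Measure.tendsto_eval_ae_ae (μ := μ) (i := i)).eventually (hbound i)

namespace Tensor

section EntryLaw

open ProbabilityTheory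

variable {F s τ : ℝ}

/-- The mean of `entryLaw F s τ a`: sampling preserves the mean, dropping a small entry does
not. -/
noncomputable def entryMean (F s τ a : ℝ) : ℝ :=
  if F / s ≤ a ^ 2 then a else if a ^ 2 ≤ τ * (F / s) then 0 else a

theorem sq_sub_entryMean_le (hF : 0 ≤ F) (hs : 0 < s) (hτ : 0 ≤ τ) (a : ℝ) :
    (a - entryMean F s τ a) ^ 2 ≤ τ * (F / s) := by
  have : 0 ≤ τ * (F / s) := by positivity
  unfold entryMean
  split_ifs <;> simp_all

theorem entryLaw_eq_dirac_or_eq_bernoulliMeasure (hs : 0 < s) (a : ℝ) :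
    entryLaw F s τ a = Measure.dirac (entryMean F s τ a) ∨
    ∃ p : unitInterval, τ < p ∧ (p : ℝ) < 1 ∧ a ^ 2 = p * (F / s) ∧ entryMean F s τ a = a ∧
      entryLaw F s τ a = bernoulliMeasure (a / p) 0 p := by
  by_cases hkeep : F / s ≤ a ^ 2
  · left; simp only [entryLaw, entryMean, if_pos hkeep]
  by_cases hdrop : a ^ 2 ≤ τ * (F / s)
  · left; simp only [entryLaw, entryMean, if_neg hkeep, if_pos hdrop]
  right
  have hFs : 0 < F / s := (sq_nonneg a).trans_lt (not_le.1 hkeep)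
  have hF : 0 < F := (div_pos_iff_of_pos_right hs).1 hFs
  have hp : a ^ 2 = s * a ^ 2 / F * (F / s) := by field_simp
  have hp0 : 0 ≤ s * a ^ 2 / F := by positivity
  have hp1 : s * a ^ 2 / F < 1 :=
    (mul_lt_iff_lt_one_left hFs).1 (hp.symm.trans_lt (not_le.1 hkeep))
  refine ⟨⟨s * a ^ 2 / F, hp0, hp1.le⟩, ?_, hp1, hp, ?_, ?_⟩
  · exact lt_of_mul_lt_mul_right ((not_le.1 hdrop).trans_eq hp) hFs.le
  · simp only [entryMean, if_neg hkeep, if_neg hdrop]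
  · rw [entryLaw, if_neg hkeep, if_neg hdrop, bernoulliMeasure_def]
    congr 2
    · exact congrArg ENNReal.ofNNReal (Real.toNNReal_of_nonneg hp0)
    · exact congrArg ENNReal.ofNNReal (Real.toNNReal_of_nonneg (sub_nonneg.2 hp1.le))

theorem integral_sub_entryMean (hs : 0 < s) (hτ : 0 < τ) (a : ℝ) :
    ∫ y, (y - entryMean F s τ a) ∂entryLaw F s τ a = 0 := by
  rcases entryLaw_eq_dirac_or_eq_bernoulliMeasure (F := F) (τ := τ) hs a with
    hlaw | ⟨p, hτp, -, -, hmean, hlaw⟩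
  · rw [hlaw, integral_dirac, sub_self]
  · have hp0 : (0 : ℝ) < p := hτ.trans hτp
    rw [hlaw, hmean, integral_bernoulliMeasure, smul_eq_mul, smul_eq_mul]
    field_simp
    ring

theorem integral_sq_sub_entryMean_le (hF : 0 ≤ F) (hs : 0 < s) (hτ : 0 < τ) (a : ℝ) :
    ∫ y, (y - entryMean F s τ a) ^ 2 ∂entryLaw F s τ a ≤ F / s := by
  have hFs : 0 ≤ F / s := by positivity
  rcases entryLaw_eq_dirac_or_eq_bernoulliMeasure (F := F) (τ := τ) hs a with
    hlaw | ⟨p, hτp, -, ha, hmean, hlaw⟩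
  · rw [hlaw, integral_dirac, sub_self]
    simpa using hFs
  · have hp0 : (0 : ℝ) < p := hτ.trans hτp
    rw [hlaw, hmean, integral_bernoulliMeasure, smul_eq_mul, smul_eq_mul]
    calc p * (a / p - a) ^ 2 + (1 - p) * (0 - a) ^ 2 = a ^ 2 / p * (1 - p) := by field_simp; ring
      _ = F / s * (1 - p) := by rw [ha, mul_div_cancel_left₀ _ hp0.ne']
      _ ≤ F / s := mul_le_of_le_one_right hFs (by linarith)

theorem ae_sq_sub_entryMean_le (hF : 0 ≤ F) (hs : 0 < s) (hτ : 0 < τ) (a : ℝ) :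
    ∀ᵐ y ∂entryLaw F s τ a, (y - entryMean F s τ a) ^ 2 ≤ F / s / τ := by
  have hFs : 0 ≤ F / s := by positivity
  rcases entryLaw_eq_dirac_or_eq_bernoulliMeasure (F := F) (τ := τ) hs a with
    hlaw | ⟨p, hτp, hp1, ha, hmean, hlaw⟩
  · rw [hlaw, ae_dirac_eq]
    simpa using div_nonneg hFs hτ.le
  · have hp0 : (0 : ℝ) < p := hτ.trans hτp
    have hle : F / s / p ≤ F / s / τ := by gcongr
    rw [hlaw, hmean, bernoulliMeasure_def, ae_add_measure_iff]
    constructor <;> refine Measure.ae_smul_measure ?_ _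
    · rw [ae_dirac_eq]
      refine le_trans ?_ hle
      calc (a / p - a) ^ 2 = a ^ 2 / p / p * (1 - p) ^ 2 := by field_simp
        _ = F / s / p * (1 - p) ^ 2 := by rw [ha, mul_div_cancel_left₀ _ hp0.ne']
        _ ≤ F / s / p := mul_le_of_le_one_right (by positivity) (by nlinarith)
    · rw [ae_dirac_eq]
      refine le_trans ?_ hle
      calc (0 - a) ^ 2 = p * (F / s) := by rw [zero_sub, neg_sq, ha]
        _ ≤ F / s := mul_le_of_le_one_left hFs hp1.le
        _ ≤ F / s / p := le_div_self hFs hp0 hp1.le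

end EntryLaw

section Sparsification

variable {d n : ℕ} {s : ℝ}

/-- The relative threshold `ln² n / n ^ (d / 2)` below which the algorithm drops an entry. -/
noncomputable def threshold (d n : ℕ) : ℝ := Real.log n ^ 2 / (n : ℝ) ^ ((d : ℝ) / 2)

/-- The entrywise mean of the output of the sparsification algorithm. -/
noncomputable def mean (A : Tensor d n) (s : ℝ) : Tensor d n :=
  fun i => entryMean (A.frobNorm ^ 2) s (threshold d n) (A i)

theorem threshold_pos (hn : 2 ≤ n) : 0 < threshold d n := by
  have hL : 2 / 3 ≤ Real.log n := two_thirds_le_log hn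
  unfold threshold
  positivity

theorem isBoundedNoise_sparsifyLaw (hn : 2 ≤ n) (A : Tensor d n) (hs : 0 < s) :
    IsBoundedNoise (fun i T => T i - A.mean s i) (A.sparsifyLaw s)
      (A.frobNorm ^ 2 / s) (A.frobNorm ^ 2 / s / threshold d n) :=
  have (i : Fin d → Fin n) :=
    isProbabilityMeasure_entryLaw (sq_nonneg A.frobNorm) s (threshold d n) (A i)
  IsBoundedNoise.pi (μ := fun i => entryLaw (A.frobNorm ^ 2) s (threshold d n) (A i))
    (fun i => integral_sub_entryMean hs (threshold_pos hn) (A i))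
    (fun i => integral_sq_sub_entryMean_le (sq_nonneg _) hs (threshold_pos hn) (A i))
    (fun i => ae_sq_sub_entryMean_le (sq_nonneg _) hs (threshold_pos hn) (A i))

theorem frobNorm_sub_mean_le (hn : 0 < n) (A : Tensor d n) (hs : 0 < s) :
    (A - A.mean s).frobNorm ≤
      √((n : ℝ) ^ ((d : ℝ) / 2) * Real.log n ^ 2 / s) * A.frobNorm := by
  have hn0 : (0 : ℝ) < n := by exact_mod_cast hn
  have hτ : 0 ≤ threshold d n := by unfold threshold; positivity
  have hcard : (n : ℝ) ^ d = (n : ℝ) ^ ((d : ℝ) / 2) * (n : ℝ) ^ ((d : ℝ) / 2) := by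
    rw [← Real.rpow_add hn0, add_halves, Real.rpow_natCast]
  refine Real.sqrt_le_iff.2 ⟨mul_nonneg (Real.sqrt_nonneg _) A.frobNorm_nonneg, ?_⟩
  rw [mul_pow, Real.sq_sqrt (by positivity)]
  calc ∑ i, (A i - A.mean s i) ^ 2
      ≤ ∑ _i : Fin d → Fin n, threshold d n * (A.frobNorm ^ 2 / s) :=
        Finset.sum_le_sum fun i _ => sq_sub_entryMean_le (sq_nonneg _) hs hτ (A i)
    _ = (n : ℝ) ^ d * (threshold d n * (A.frobNorm ^ 2 / s)) := by simp
    _ = (n : ℝ) ^ ((d : ℝ) / 2) * Real.log n ^ 2 / s * A.frobNorm ^ 2 := by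
        rw [hcard, threshold]
        field_simp

end Sparsification

end Tensor

theorem mul_sqrt_div_le_of_le {a b ε s : ℝ} (ha : 0 ≤ a) (hε : 0 < ε) (hs : 0 < s)
    (h : a ^ 2 * b / ε ^ 2 ≤ s) : a * √(b / s) ≤ ε := by
  rw [← Real.sqrt_sq ha, ← Real.sqrt_mul (sq_nonneg a), Real.sqrt_le_left hε.le, ← mul_div_assoc,
    div_le_iff₀ hs]
  rw [div_le_iff₀ (by positivity)] at h
  linarith

theorem sq_rpow_three_halves {x : ℝ} (hx : 0 ≤ x) : (x ^ ((3 : ℝ) / 2)) ^ 2 = x ^ 3 := by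
  rw [← Real.rpow_mul_natCast hx]
  norm_num

namespace Tensor

section ErrorBound

variable {d n : ℕ} {s : ℝ}

/-- The square of the relative error `‖A - T‖₂ / ‖A‖_F` of sparsification is at most an absolute
constant times `errorRate d n / s`. The base `5` is the squared radius of the dyadic net. -/
noncomputable def errorRate (d n : ℕ) : ℝ :=
  d ^ 3 * 5 ^ d * ((n : ℝ) ^ ((d : ℝ) / 2) * Real.log n ^ 3)

theorem le_rpow_half (hn : 0 < n) (hd : 2 ≤ d) : (n : ℝ) ≤ (n : ℝ) ^ ((d : ℝ) / 2) := by
  have hd2 : (2 : ℝ) ≤ d := by exact_mod_cast hd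
  exact Real.self_le_rpow_of_one_le (by exact_mod_cast hn) (by linarith)

theorem sparsify_fibre_bound_le (hn : 2 ≤ n) (hd : 2 ≤ d) {v : ℝ} (hv : 0 ≤ v) :
    2 * n * v + v / threshold d n * (5 * d * Real.log n) ≤
      9 * d * (n : ℝ) ^ ((d : ℝ) / 2) * v := by
  have hd2 : (2 : ℝ) ≤ d := by exact_mod_cast hd
  have hL : 2 / 3 ≤ Real.log n := two_thirds_le_log hn
  have hnN : (n : ℝ) ≤ (n : ℝ) ^ ((d : ℝ) / 2) := le_rpow_half (by omega) hd
  have hinv : 5 / Real.log n ≤ 15 / 2 := by rw [div_le_iff₀ (by linarith)]; linarith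
  calc 2 * n * v + v / threshold d n * (5 * d * Real.log n)
      = 2 * n * v + 5 / Real.log n * (d * (n : ℝ) ^ ((d : ℝ) / 2) * v) := by
        rw [threshold]
        field_simp
    _ ≤ d * (n : ℝ) ^ ((d : ℝ) / 2) * v + 15 / 2 * (d * (n : ℝ) ^ ((d : ℝ) / 2) * v) := by gcongr
    _ ≤ 9 * d * (n : ℝ) ^ ((d : ℝ) / 2) * v := by
        have : 0 ≤ d * (n : ℝ) ^ ((d : ℝ) / 2) * v := by positivity
        linarith

theorem log_mul_levelDeviation_le (hs : 0 < s) {f : ℝ} (hf : 0 ≤ f) :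
    4 * Real.log n * levelDeviation d n (9 * d * (n : ℝ) ^ ((d : ℝ) / 2) * (f ^ 2 / s)) ≤
      120 * √(errorRate d n / s) * f := by
  refine le_of_abs_le (abs_le_of_sq_le_sq ?_ (by positivity))
  rw [levelDeviation, errorRate, mul_pow, mul_pow, mul_pow, mul_pow, Real.sq_sqrt (by positivity),
    Real.sq_sqrt (by positivity)]
  calc 4 ^ 2 * Real.log n ^ 2 * (96 * 5 ^ d * d ^ 2 *
        (9 * d * (n : ℝ) ^ ((d : ℝ) / 2) * (f ^ 2 / s)) * Real.log n)
      = 13824 * (d ^ 3 * 5 ^ d * ((n : ℝ) ^ ((d : ℝ) / 2) * Real.log n ^ 3) / s * f ^ 2) := by ring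
    _ ≤ 14400 * (d ^ 3 * 5 ^ d * ((n : ℝ) ^ ((d : ℝ) / 2) * Real.log n ^ 3) / s * f ^ 2) := by
        gcongr
        norm_num
    _ = _ := by ring

theorem rpow_half_mul_log_sq_le_errorRate (hn : 2 ≤ n) (hd : 0 < d) :
    (n : ℝ) ^ ((d : ℝ) / 2) * Real.log n ^ 2 ≤ errorRate d n := by
  have hL : 2 / 3 ≤ Real.log n := two_thirds_le_log hn
  have hd3 : (1 : ℝ) ≤ d ^ 3 := one_le_pow₀ (by exact_mod_cast hd)
  have h5 : (5 : ℝ) ≤ 5 ^ d := le_self_pow₀ (by norm_num) hd.ne'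
  have hfactor : 1 ≤ d ^ 3 * 5 ^ d * Real.log n := by
    calc (1 : ℝ) ≤ 1 * 5 * (2 / 3) := by norm_num
      _ ≤ d ^ 3 * 5 ^ d * Real.log n := by gcongr
  calc (n : ℝ) ^ ((d : ℝ) / 2) * Real.log n ^ 2
      ≤ (n : ℝ) ^ ((d : ℝ) / 2) * Real.log n ^ 2 * (d ^ 3 * 5 ^ d * Real.log n) :=
        le_mul_of_one_le_right (by positivity) hfactor
    _ = errorRate d n := by rw [errorRate]; ring

theorem one_sub_le_measureReal_spectralNorm_sub_le (hn : 2 ≤ n) (hd : 2 ≤ d) (A : Tensor d n)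
    (hs : 0 < s) : 1 - 1 / (n : ℝ) ≤ (A.sparsifyLaw s).real
      {T | (A - T).spectralNorm ≤ 121 * √(errorRate d n / s) * A.frobNorm} := by
  have hbias : (A - A.mean s).spectralNorm ≤ √(errorRate d n / s) * A.frobNorm := by
    refine (spectralNorm_le_frobNorm _).trans ((frobNorm_sub_mean_le (by omega) A hs).trans ?_)
    have := A.frobNorm_nonneg
    gcongr
    exact rpow_half_mul_log_sq_le_errorRate hn (by omega)
  have hv : 0 ≤ A.frobNorm ^ 2 / s := by positivity
  refine (one_sub_le_measureReal_spectralNorm_le hn (by omega)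
    (isBoundedNoise_sparsifyLaw hn A hs) (sparsify_fibre_bound_le hn hd hv)).trans
    (measureReal_mono fun T hT => ?_)
  calc (A - T).spectralNorm = ((A - A.mean s) - (T - A.mean s)).spectralNorm := by
        rw [sub_sub_sub_cancel_right]
    _ ≤ (A - A.mean s).spectralNorm + (T - A.mean s).spectralNorm := spectralNorm_sub_le _ _
    _ ≤ √(errorRate d n / s) * A.frobNorm + 120 * √(errorRate d n / s) * A.frobNorm :=
        add_le_add hbias (le_trans hT (log_mul_levelDeviation_le hs A.frobNorm_nonneg))
    _ = 121 * √(errorRate d n / s) * A.frobNorm := by ring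

theorem one_sub_le_measureReal_spectralNorm_sub_le_mul_frobNorm (hn : 2 ≤ n) (hd : 2 ≤ d)
    (A : Tensor d n) {ε : ℝ} (hε : 0 < ε) (hs : 121 ^ 2 * errorRate d n / ε ^ 2 ≤ s) :
    1 - 1 / (n : ℝ) ≤ (A.sparsifyLaw s).real {T | (A - T).spectralNorm ≤ ε * A.frobNorm} := by
  have hL : 2 / 3 ≤ Real.log n := two_thirds_le_log hn
  have hs0 : 0 < s := hs.trans_lt' (by unfold errorRate; positivity)
  exact (one_sub_le_measureReal_spectralNorm_sub_le hn hd A hs0).trans <|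
    measureReal_mono fun T hT => le_trans hT <| mul_le_mul_of_nonneg_right
      (mul_sqrt_div_le_of_le (by norm_num) hε hs0 hs) A.frobNorm_nonneg

theorem errorRate_le (d n : ℕ) :
    errorRate d n ≤ d ^ 3 * 64 ^ d * ((n : ℝ) ^ ((d : ℝ) / 2) * Real.log n ^ 3) := by
  unfold errorRate
  gcongr
  norm_num

theorem sqrt_errorRate_div_le (d n : ℕ) (hs : 0 < s) :
    √(errorRate d n / s) ≤ (d : ℝ) ^ ((3 : ℝ) / 2) * 8 ^ d *
      √((n : ℝ) ^ ((d : ℝ) / 2) * Real.log n ^ 3 / s) := by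
  have h64 : ((8 : ℝ) ^ d) ^ 2 = 64 ^ d := by rw [pow_right_comm]; norm_num
  rw [← Real.sqrt_sq (by positivity : 0 ≤ (d : ℝ) ^ ((3 : ℝ) / 2) * 8 ^ d),
    ← Real.sqrt_mul (sq_nonneg _), mul_pow, sq_rpow_three_halves d.cast_nonneg, h64,
    ← mul_div_assoc]
  gcongr
  exact errorRate_le d n

theorem errorRate_two (n : ℕ) : errorRate 2 n = 200 * (n * Real.log n ^ 3) := by
  norm_num [errorRate]

theorem measureReal_spectralNorm_sub_le_le_matrixSpectralNorm (M : Matrix (Fin n) (Fin n) ℝ)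
    {P : Measure (Tensor 2 n)} [IsFiniteMeasure P] (t : ℝ) :
    P.real {T | (ofMatrix M - T).spectralNorm ≤ t * (ofMatrix M).frobNorm} ≤
      P.real {T | matrixSpectralNorm (M - T.toMatrix) ≤ t * matrixFrobNorm M} :=
  measureReal_mono fun T hT => by
    rw [← frobNorm_ofMatrix]
    refine le_trans (matrixSpectralNorm_le_spectralNorm_ofMatrix _) ?_
    rw [ofMatrix_sub_toMatrix]
    exact hT

end ErrorBound

end Tensor

theorem mainTheorem3_general :
    (∃ c : ℝ, 0 < c ∧
      ∀ (n d : ℕ), 2 ≤ n → 2 ≤ d →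
      ∀ (A : Tensor d n) (s : ℝ), 0 < s →
        1 - 1 / (n : ℝ) ≤ (A.sparsifyLaw s).real
          {T | (A - T).spectralNorm ≤
            c * (d : ℝ) ^ ((3 : ℝ) / 2) * 8 ^ d *
              Real.sqrt ((n : ℝ) ^ ((d : ℝ) / 2) * Real.log n ^ 3 / s) * A.frobNorm}) ∧
    (∃ C : ℝ, 0 < C ∧
      ∀ (n d : ℕ), 2 ≤ n → 2 ≤ d →
      ∀ (A : Tensor d n) (ε s : ℝ), 0 < ε →
        C * ((d : ℝ) ^ 3 * 64 ^ d * (n : ℝ) ^ ((d : ℝ) / 2) * Real.log n ^ 3 / ε ^ 2) ≤ s →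
        1 - 1 / (n : ℝ) ≤ (A.sparsifyLaw s).real
          {T | (A - T).spectralNorm ≤ ε * A.frobNorm}) ∧
    (∃ c : ℝ, 0 < c ∧
      ∀ n : ℕ, 2 ≤ n →
      ∀ (M : Matrix (Fin n) (Fin n) ℝ) (s : ℝ), 0 < s →
        1 - 1 / (n : ℝ) ≤ ((Tensor.ofMatrix M).sparsifyLaw s).real
          {T | matrixSpectralNorm (M - T.toMatrix) ≤
            c * Real.sqrt (n * Real.log n ^ 3 / s) * matrixFrobNorm M}) ∧
    (∃ C : ℝ, 0 < C ∧
      ∀ n : ℕ, 2 ≤ n →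
      ∀ (M : Matrix (Fin n) (Fin n) ℝ) (ε s : ℝ), 0 < ε →
        C * (n * Real.log n ^ 3 / ε ^ 2) ≤ s →
        1 - 1 / (n : ℝ) ≤ ((Tensor.ofMatrix M).sparsifyLaw s).real
          {T | matrixSpectralNorm (M - T.toMatrix) ≤ ε * matrixFrobNorm M}) := by
  refine ⟨⟨121, by norm_num, fun n d hn hd A s hs => ?_⟩,
    ⟨121 ^ 2, by norm_num, fun n d hn hd A ε s hε hs => ?_⟩,
    ⟨121 * √200, by positivity, fun n hn M s hs => ?_⟩,
    ⟨121 ^ 2 * 200, by norm_num, fun n hn M ε s hε hs => ?_⟩⟩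
  · refine (A.one_sub_le_measureReal_spectralNorm_sub_le hn hd hs).trans
      (measureReal_mono fun T (hT : (A - T).spectralNorm ≤ _) => hT.trans ?_)
    simpa only [mul_assoc] using mul_le_mul_of_nonneg_right
      (mul_le_mul_of_nonneg_left (Tensor.sqrt_errorRate_div_le d n hs)
        (by norm_num : (0 : ℝ) ≤ 121)) A.frobNorm_nonneg
  · refine A.one_sub_le_measureReal_spectralNorm_sub_le_mul_frobNorm hn hd hε (le_trans ?_ hs)
    rw [mul_div_assoc]
    gcongr
    simpa only [mul_assoc] using Tensor.errorRate_le d n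
  · rw [mul_assoc 121, ← Real.sqrt_mul (by norm_num), ← mul_div_assoc, ← Tensor.errorRate_two]
    exact (Tensor.one_sub_le_measureReal_spectralNorm_sub_le hn le_rfl _ hs).trans
      (Tensor.measureReal_spectralNorm_sub_le_le_matrixSpectralNorm M _)
  · have hs' : 121 ^ 2 * Tensor.errorRate 2 n / ε ^ 2 ≤ s := by
      rwa [Tensor.errorRate_two, ← mul_assoc, mul_div_assoc]
    exact (Tensor.one_sub_le_measureReal_spectralNorm_sub_le_mul_frobNorm hn le_rfl _ hε hs').trans
      (Tensor.measureReal_spectralNorm_sub_le_le_matrixSpectralNorm M ε)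

theorem mainTheorem3 :
    (∃ c : ℝ, 0 < c ∧
      ∀ (n d : ℕ), 300 ≤ n → 2 ≤ d → (d : ℝ) ≤ 0.5 * Real.log n →
      ∀ (A : Tensor d n) (s : ℝ), 0 < s →
        1 - 1 / (n : ℝ) ≤ (A.sparsifyLaw s).real
          {T | (A - T).spectralNorm ≤
            c * (d : ℝ) ^ ((3 : ℝ) / 2) * 8 ^ d *
              Real.sqrt ((n : ℝ) ^ ((d : ℝ) / 2) * Real.log n ^ 3 / s) * A.frobNorm}) ∧
    (∃ C : ℝ, 0 < C ∧
      ∀ (n d : ℕ), 300 ≤ n → 2 ≤ d → (d : ℝ) ≤ 0.5 * Real.log n →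
      ∀ (A : Tensor d n) (ε s : ℝ), 0 < ε →
        C * ((d : ℝ) ^ 3 * 64 ^ d * (n : ℝ) ^ ((d : ℝ) / 2) * Real.log n ^ 3 / ε ^ 2) ≤ s →
        1 - 1 / (n : ℝ) ≤ (A.sparsifyLaw s).real
          {T | (A - T).spectralNorm ≤ ε * A.frobNorm}) ∧
    (∃ c : ℝ, 0 < c ∧
      ∀ n : ℕ, 300 ≤ n →
      ∀ (M : Matrix (Fin n) (Fin n) ℝ) (s : ℝ), 0 < s →
        1 - 1 / (n : ℝ) ≤ ((Tensor.ofMatrix M).sparsifyLaw s).real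
          {T | matrixSpectralNorm (M - T.toMatrix) ≤
            c * Real.sqrt (n * Real.log n ^ 3 / s) * matrixFrobNorm M}) ∧
    (∃ C : ℝ, 0 < C ∧
      ∀ n : ℕ, 300 ≤ n →
      ∀ (M : Matrix (Fin n) (Fin n) ℝ) (ε s : ℝ), 0 < ε →
        C * (n * Real.log n ^ 3 / ε ^ 2) ≤ s →
        1 - 1 / (n : ℝ) ≤ ((Tensor.ofMatrix M).sparsifyLaw s).real
          {T | matrixSpectralNorm (M - T.toMatrix) ≤ ε * matrixFrobNorm M}) := by
  obtain ⟨⟨c, hc, tensor⟩, ⟨C, hC, tensorSample⟩, ⟨c', hc', matrix⟩, C', hC', matrixSample⟩ :=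
    mainTheorem3_general
  exact ⟨⟨c, hc, fun n d hn hd _ => tensor n d (by omega) hd⟩,
    ⟨C, hC, fun n d hn hd _ => tensorSample n d (by omega) hd⟩,
    ⟨c', hc', fun n hn => matrix n (by omega)⟩, C', hC', fun n hn => matrixSample n (by omega)⟩
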